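/- Let $d\ge 1$ be an integer. Let $U$ be the hyperbolic plane, $E_8(-1)$ the negative definite $E_8$-lattice, $M:=U^{\oplus 2}\oplus E_8(-1)^{\oplus 2}$, $\Lambda:=U\oplus M$ the K3 lattice, and $L_{2d}:=\langle k\rangle\oplus M$ with $k^2=-2d$, identified with $h^\perp\subset\Lambda$ for a primitive vector $h\in\Lambda$ with $h^2=2d$. Let $A_{L_{2d}}=L_{2d}^\vee/L_{2d}$ be the discriminant group with its quadratic form with values in $\mathbb{Q}/2\mathbb{Z}$, ${\rm O}(A_{L_{2d}})$ the group of its isometries, and $G_{2d}:={\rm O}(A_{L_{2d}})/\{\pm{\rm id}\}$; the natural map ${\rm O}(L_{2d})\to G_{2d}$, $f\mapsto[f]$, is surjective. Put $$D_{2d}:=\{\sigma\in\mathbb{P}(L_{2d}\otimes\mathbb{C}):\sigma\cdot\sigma=0,\ \sigma\cdot\overline{\sigma}>0\},\qquad {\cal K}_{2d}:=D_{2d}/\Gamma_{2d},$$ where $\Gamma_{2d}\subset{\rm O}(L_{2d})$ is the group of restrictions to $h^\perp=L_{2d}$ of the isometries of $\Lambda$ fixing $h$. The group $G_{2d}$ acts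 on ${\cal K}_{2d}$ by $[f]\cdot[\sigma]=[f(\sigma)]$ for $f\in{\rm O}(L_{2d})$ and $\sigma\in D_{2d}$. For a primitive sublattice $L\subset L_{2d}$ of signature $(2,18)$ let the Heegner divisor ${\cal H}_L\subset{\cal K}_{2d}$ be the image of $D_L:=\mathbb{P}(L\otimes\mathbb{C})\cap D_{2d}$, and let $V({\cal H}_L)$ be the orthogonal complement of $L$ in $L_{2d}$. Let $\Re$ be the set of the sublattices $\langle\beta\rangle\subset L_{2d}$ such that, writing $\beta=\alpha k+mj$ with $\alpha,m\in\mathbb{Z}$ and $j\in M$ primitive, (a) $\beta$ is primitive in $L_{2d}$, and $\beta^2$ divides $2m$ and $2d$; (b) $\beta^2<0$, $\beta^2\ne-2$ and $\beta^2\ne-2d$. **Lemma 3.5.** Let $L$ be a primitive sublattice of $L_{2d}$ of signature $(2,18)$. There is a non-trivial $g\in G_{2d}$ that fixes every point of ${\cal H}_L$ if and only if $V({\cal H}_L)\in\Re$. -/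

import Mathlib

open Matrix
open scoped LinearAlgebra.Projectivization

namespace K3Period

noncomputable section

section General

variable {ι : Type*} [Fintype ι] [DecidableEq ι]

/-- The image of an integral vector in `ι → R`. -/
def vecCast (R : Type*) [CommRing R] : (ι → ℤ) →ₗ[ℤ] (ι → R) where
  toFun x i := (x i : R)
  map_add' x y := by ext i; simp
  map_smul' n x := by ext i; simp

/-- The bilinear form with Gram matrix `G`, extended to `ι → R`. -/
def form (R : Type*) [CommRing R] (G : Matrix ι ι ℤ) : LinearMap.BilinForm R (ι → R) :=
  Matrix.toBilin' (G.map (Int.cast : ℤ → R))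

/-- The orthogonal direct sum of two Gram matrices. -/
def osum {m n : Type*} (A : Matrix m m ℤ) (B : Matrix n n ℤ) : Matrix (m ⊕ n) (m ⊕ n) ℤ :=
  Matrix.fromBlocks A 0 0 B

/-- The isometry group of the lattice `ℤ^ι` with Gram matrix `G`. -/
def isometryGroup (G : Matrix ι ι ℤ) : Subgroup (GL ι ℤ) where
  carrier := {g | ∀ x y : ι → ℤ, form ℤ G (g.val *ᵥ x) (g.val *ᵥ y) = form ℤ G x y}
  mul_mem' {a b} ha hb x y := by
    simp only [Set.mem_ofPred_eq] at ha hb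
    rw [Units.val_mul, ← Matrix.mulVec_mulVec, ← Matrix.mulVec_mulVec, ha, hb]
  one_mem' x y := by simp
  inv_mem' {a} ha x y := by
    simp only [Set.mem_ofPred_eq] at ha
    rw [← ha]
    simp only [Matrix.mulVec_mulVec, ← Units.val_mul, mul_inv_cancel, Units.val_one,
      Matrix.one_mulVec]

/-- The `R`-linear extension of an automorphism of `ℤ^ι`. -/
def extend (R : Type*) [CommRing R] : GL ι ℤ →* LinearMap.GeneralLinearGroup R (ι → R) :=
  Matrix.GeneralLinearGroup.toLin.toMonoidHom.comp
    (Matrix.GeneralLinearGroup.map (Int.castRingHom R))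

lemma extend_apply (R : Type*) [CommRing R] (g : GL ι ℤ) (v : ι → R) :
    (extend R g).val v = (g.val.map (Int.cast : ℤ → R)) *ᵥ v := by
  rfl

lemma extend_vecCast (R : Type*) [CommRing R] (g : GL ι ℤ) (x : ι → ℤ) :
    (extend R g).val (vecCast R x) = vecCast R (g.val *ᵥ x) := by
  funext i
  exact (RingHom.map_mulVec (Int.castRingHom R) g.val x i).symm

lemma form_vecCast (R : Type*) [CommRing R] (G : Matrix ι ι ℤ) (x y : ι → ℤ) :
    form R G (vecCast R x) (vecCast R y) = ((form ℤ G x y : ℤ) : R) := by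
  simp only [form, Matrix.toBilin'_apply, vecCast]
  simp

lemma gram_of_mem {G : Matrix ι ι ℤ} {g : GL ι ℤ} (hg : g ∈ isometryGroup G) :
    g.valᵀ * G * g.val = G := by
  apply (Matrix.toBilin' (R₁ := ℤ)).injective
  refine LinearMap.ext fun x => LinearMap.ext fun y => ?_
  have := hg x y
  simp only [form, Matrix.toBilin'_apply'] at this
  have e : (G.map (Int.cast : ℤ → ℤ)) = G := by ext; simp
  rw [e] at this
  rw [Matrix.toBilin'_apply', Matrix.toBilin'_apply', ← this]
  simp only [← Matrix.mulVec_mulVec, Matrix.dotProduct_mulVec, Matrix.vecMul_transpose]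

lemma form_extend (R : Type*) [CommRing R] {G : Matrix ι ι ℤ} {g : GL ι ℤ}
    (hg : g ∈ isometryGroup G) (v w : ι → R) :
    form R G ((extend R g).val v) ((extend R g).val w) = form R G v w := by
  have h := congrArg (fun A : Matrix ι ι ℤ => A.map (Int.castRingHom R)) (gram_of_mem hg)
  simp only [Matrix.map_mul] at h
  simp only [extend_apply, form, Matrix.toBilin'_apply']
  change _ = v ⬝ᵥ (G.map (Int.castRingHom R)) *ᵥ w
  rw [← h]
  simp only [← Matrix.mulVec_mulVec, Matrix.dotProduct_mulVec, Matrix.transpose_map,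
    Matrix.vecMul_transpose]
  rfl

/-- The lattice `ℤ^ι` inside `ℚ^ι`. -/
def latticeQ (ι : Type*) : Submodule ℤ (ι → ℚ) := LinearMap.range (vecCast ℚ)

/-- The dual lattice, realised as `{x ∈ ℚ^ι | x · y ∈ ℤ for all y ∈ ℤ^ι}`. -/
def dualLattice (G : Matrix ι ι ℤ) : Submodule ℤ (ι → ℚ) :=
  (form ℚ G).dualSubmodule (latticeQ ι)

/-- The discriminant group `L^∨ / L`. -/
abbrev Disc (G : Matrix ι ι ℤ) : Type _ :=
  dualLattice G ⧸ (latticeQ ι).submoduleOf (dualLattice G)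

lemma extend_mem_latticeQ (g : GL ι ℤ) {x : ι → ℚ} (hx : x ∈ latticeQ ι) :
    (extend ℚ g).val x ∈ latticeQ ι := by
  obtain ⟨y, rfl⟩ := hx
  exact ⟨g.val *ᵥ y, (extend_vecCast ℚ g y).symm⟩

lemma extend_mem_dualLattice {G : Matrix ι ι ℤ} {g : GL ι ℤ} (hg : g ∈ isometryGroup G)
    {x : ι → ℚ} (hx : x ∈ dualLattice G) : (extend ℚ g).val x ∈ dualLattice G := by
  intro y hy
  have h := hx _ (extend_mem_latticeQ g⁻¹ hy)
  rw [← form_extend ℚ hg] at h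
  rwa [← Module.End.mul_apply, ← Units.val_mul, ← map_mul, mul_inv_cancel, map_one,
    Units.val_one, Module.End.one_apply] at h

/-- The endomorphism of the dual lattice induced by an isometry. -/
def dualMap {G : Matrix ι ι ℤ} (g : isometryGroup G) : dualLattice G →ₗ[ℤ] dualLattice G :=
  ((extend ℚ g.1).val.restrictScalars ℤ).restrict fun _ hx => extend_mem_dualLattice g.2 hx

lemma dualMap_le {G : Matrix ι ι ℤ} (g : isometryGroup G) :
    (latticeQ ι).submoduleOf (dualLattice G) ≤
      ((latticeQ ι).submoduleOf (dualLattice G)).comap (dualMap g) :=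
  fun x hx => extend_mem_latticeQ g.1 (x := x.1) hx

/-- The action of the isometry group on the discriminant group. -/
def discEnd (G : Matrix ι ι ℤ) : isometryGroup G →* Module.End ℤ (Disc G) where
  toFun g := Submodule.mapQ _ _ (dualMap g) (dualMap_le g)
  map_one' := by
    apply LinearMap.ext
    intro a
    obtain ⟨x, rfl⟩ := Submodule.Quotient.mk_surjective _ a
    rw [Submodule.mapQ_apply, Module.End.one_apply]
    congr 1
    apply Subtype.ext
    change (extend ℚ (1 : GL ι ℤ)).val x.1 = x.1
    rw [map_one]; rfl
  map_mul' g h := by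
    apply LinearMap.ext
    intro a
    obtain ⟨x, rfl⟩ := Submodule.Quotient.mk_surjective _ a
    rw [Submodule.mapQ_apply, Module.End.mul_apply, Submodule.mapQ_apply, Submodule.mapQ_apply]
    congr 1
    apply Subtype.ext
    change (extend ℚ (g.1 * h.1)).val x.1 = (extend ℚ g.1).val ((extend ℚ h.1).val x.1)
    rw [map_mul]; rfl

lemma discEnd_mk {G : Matrix ι ι ℤ} (g : isometryGroup G) (x : dualLattice G) :
    discEnd G g (Submodule.Quotient.mk x) =
      Submodule.Quotient.mk ⟨(extend ℚ g.1).val x.1, extend_mem_dualLattice g.2 x.2⟩ := rfl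

end General

/-- The hyperbolic plane. -/
def gramU : Matrix (Fin 2) (Fin 2) ℤ := !![0, 1; 1, 0]

/-- `E₈(-1)`. -/
def gramE : Matrix (Fin 8) (Fin 8) ℤ := -CartanMatrix.E₈

abbrev IdxM : Type := Fin 2 ⊕ (Fin 2 ⊕ (Fin 8 ⊕ Fin 8))

/-- The lattice `M = U ⊕ U ⊕ E₈(-1) ⊕ E₈(-1)`. -/
def gramM : Matrix IdxM IdxM ℤ := osum gramU (osum gramU (osum gramE gramE))

abbrev IdxL : Type := Unit ⊕ IdxM

/-- The lattice `L_{2d} = ⟨k⟩ ⊕ M` with `k² = -2d`. -/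
def gramL (d : ℕ) : Matrix IdxL IdxL ℤ := osum (Matrix.of fun _ _ => -(2 * (d : ℤ))) gramM

abbrev IdxK3 : Type := Fin 2 ⊕ IdxM

/-- The K3 lattice `Λ = U ⊕ M`. -/
def gramK3 : Matrix IdxK3 IdxK3 ℤ := osum gramU gramM

/-! Elementary facts on these forms. -/

lemma form_osum {m n : Type*} [Fintype m] [DecidableEq m] [Fintype n] [DecidableEq n]
    (R : Type*) [CommRing R] (A : Matrix m m ℤ) (B : Matrix n n ℤ) (x y : m ⊕ n → R) :
    form R (osum A B) x y =
      form R A (x ∘ Sum.inl) (y ∘ Sum.inl) + form R B (x ∘ Sum.inr) (y ∘ Sum.inr) := by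
  simp [form, osum, Matrix.toBilin'_apply, Fintype.sum_sum_type]

lemma isSymm_osum {m n : Type*} {A : Matrix m m ℤ} {B : Matrix n n ℤ}
    (hA : A.IsSymm) (hB : B.IsSymm) : (osum A B).IsSymm := by
  simp [osum, Matrix.IsSymm, Matrix.fromBlocks_transpose, hA.eq, hB.eq]

lemma isSymm_gramM : gramM.IsSymm := by
  have hE : gramE.IsSymm := by
    simp [gramE, Matrix.IsSymm, CartanMatrix.E₈_transpose]
  have hU : gramU.IsSymm := by ext i j; fin_cases i <;> fin_cases j <;> rfl
  exact isSymm_osum hU (isSymm_osum hU (isSymm_osum hE hE))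

lemma isSymm_gramL (d : ℕ) : (gramL d).IsSymm :=
  isSymm_osum (by ext; simp) isSymm_gramM

lemma form_comm {ι : Type*} [Fintype ι] [DecidableEq ι] (R : Type*) [CommRing R]
    {G : Matrix ι ι ℤ} (hG : G.IsSymm) (x y : ι → R) : form R G x y = form R G y x := by
  simp only [form, Matrix.toBilin'_apply]
  rw [Finset.sum_comm]
  refine Finset.sum_congr rfl fun i _ => Finset.sum_congr rfl fun j _ => ?_
  rw [Matrix.map_apply, Matrix.map_apply, hG.apply]
  ring

lemma form_gramU (R : Type*) [CommRing R] (x y : Fin 2 → R) :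
    form R gramU x y = x 0 * y 1 + x 1 * y 0 := by
  simp [form, gramU, Matrix.toBilin'_apply, Fin.sum_univ_two]

lemma even_gramE (x : Fin 8 → ℤ) : Even (form ℤ gramE x x) := by
  refine ⟨-(x 0 ^ 2 + x 1 ^ 2 + x 2 ^ 2 + x 3 ^ 2 + x 4 ^ 2 + x 5 ^ 2 + x 6 ^ 2 + x 7 ^ 2) +
    x 0 * x 2 + x 1 * x 3 + x 2 * x 3 + x 3 * x 4 + x 4 * x 5 + x 5 * x 6 + x 6 * x 7, ?_⟩
  simp [form, gramE, CartanMatrix.E₈, Matrix.toBilin'_apply, Fin.sum_univ_eight]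
  ring

lemma even_gramM (x : IdxM → ℤ) : Even (form ℤ gramM x x) := by
  rw [gramM, form_osum, form_osum, form_osum, form_gramU, form_gramU]
  have h (a b : ℤ) : Even (a * b + b * a) := ⟨a * b, by ring⟩
  exact (h _ _).add ((h _ _).add ((even_gramE _).add (even_gramE _)))

lemma form_gramL (d : ℕ) (R : Type*) [CommRing R] (x y : IdxL → R) :
    form R (gramL d) x y = -(2 * (d : R)) * (x (Sum.inl ()) * y (Sum.inl ())) +
      form R gramM (x ∘ Sum.inr) (y ∘ Sum.inr) := by
  rw [gramL, form_osum]
  congr 1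
  simp [form, Matrix.toBilin'_apply]
  ring

lemma even_gramL (d : ℕ) (x : IdxL → ℤ) : Even (form ℤ (gramL d) x x) := by
  rw [form_gramL]
  exact Even.add ⟨-(d * (x (Sum.inl ()) * x (Sum.inl ()))), by ring⟩ (even_gramM _)

lemma mem_dualLattice {ι : Type*} [Fintype ι] [DecidableEq ι] {G : Matrix ι ι ℤ} {x : ι → ℚ} :
    x ∈ dualLattice G ↔ ∀ y : ι → ℤ, ∃ n : ℤ, form ℚ G x (vecCast ℚ y) = n := by
  constructor
  · intro h y
    obtain ⟨n, hn⟩ := Submodule.mem_one.mp (h _ ⟨y, rfl⟩)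
    exact ⟨n, by rw [← hn]; simp⟩
  · rintro h _ ⟨y, rfl⟩
    obtain ⟨n, hn⟩ := h y
    exact Submodule.mem_one.mpr ⟨n, by rw [hn]; simp⟩

/-- The discriminant quadratic form `q : A_{L_{2d}} → ℚ/2ℤ`, `q(x + L) = x · x mod 2ℤ`. -/
def discQ (d : ℕ) (a : Disc (gramL d)) : AddCircle (2 : ℚ) :=
  Quotient.liftOn' a (fun x => ((form ℚ (gramL d) x.1 x.1 : ℚ) : AddCircle (2 : ℚ))) <| by
    intro x y hxy
    rw [Submodule.quotientRel_def] at hxy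
    obtain ⟨l, hl⟩ : x.1 - y.1 ∈ latticeQ IdxL := hxy
    obtain ⟨n, hn⟩ := mem_dualLattice.mp y.2 l
    obtain ⟨m, hm⟩ := even_gramL d l
    have hx : x.1 = y.1 + vecCast ℚ l := by rw [hl]; abel
    have hs : form ℚ (gramL d) (vecCast ℚ l) y.1 = n := by
      rw [form_comm ℚ (isSymm_gramL d), hn]
    change ((_ : ℚ) : AddCircle (2 : ℚ)) = ((_ : ℚ) : AddCircle (2 : ℚ))
    rw [← sub_eq_zero, ← AddCircle.coe_sub, AddCircle.coe_eq_zero_iff]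
    refine ⟨n + m, ?_⟩
    rw [hx]
    simp only [map_add, LinearMap.add_apply, hn, hs, form_vecCast, hm]
    simp only [zsmul_eq_mul]
    push_cast
    ring

/-- The group `O(A_{L_{2d}})` of automorphisms of the discriminant group that preserve the
discriminant quadratic form. -/
def isoDisc (d : ℕ) : Subgroup (LinearMap.GeneralLinearGroup ℤ (Disc (gramL d))) where
  carrier := {e | ∀ a, discQ d (e.val a) = discQ d a}
  mul_mem' {e f} he hf a := by
    rw [Units.val_mul, Module.End.mul_apply, he, hf]
  one_mem' a := rfl
  inv_mem' {e} he a := by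
    rw [← he, ← Module.End.mul_apply, ← Units.val_mul, mul_inv_cancel]
    rfl

/-- The natural map `Ψ : O(L_{2d}) → O(A_{L_{2d}})`. -/
def discHom (d : ℕ) : isometryGroup (gramL d) →* isoDisc d :=
  (discEnd (gramL d)).toHomUnits.codRestrict (isoDisc d) <| by
    intro g a
    obtain ⟨x, rfl⟩ := Submodule.Quotient.mk_surjective _ a
    rw [MonoidHom.coe_toHomUnits, discEnd_mk]
    change ((form ℚ (gramL d) _ _ : ℚ) : AddCircle (2 : ℚ)) =
      ((form ℚ (gramL d) _ _ : ℚ) : AddCircle (2 : ℚ))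
    rw [form_extend ℚ g.2]

lemma discHom_mk (d : ℕ) (g : isometryGroup (gramL d)) (x : dualLattice (gramL d)) :
    (discHom d g).1.val (Submodule.Quotient.mk x) =
      Submodule.Quotient.mk ⟨(extend ℚ g.1).val x.1, extend_mem_dualLattice g.2 x.2⟩ := rfl

/-- The subgroup `{± id}` of `O(A_{L_{2d}})`. -/
def pmOne (d : ℕ) : Subgroup (isoDisc d) where
  carrier := {e | e.1 = 1 ∨ e.1 = -1}
  mul_mem' {e f} he hf := by
    simp only [Set.mem_ofPred_eq, Subgroup.coe_mul] at *
    rcases he with he | he <;> rcases hf with hf | hf <;> rw [he, hf] <;> simp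
  one_mem' := Or.inl rfl
  inv_mem' {e} he := by
    simp only [Set.mem_ofPred_eq, Subgroup.coe_inv] at *
    rcases he with he | he <;> rw [he] <;> simp

instance (d : ℕ) : (pmOne d).Normal where
  conj_mem e he g := by
    rcases he with he | he
    · exact Or.inl (by simp [he])
    · exact Or.inr (by simp [he])

/-- The group `G_{2d} = O(A_{L_{2d}}) / {± id}`. -/
abbrev G2d (d : ℕ) : Type := isoDisc d ⧸ pmOne d

/-- The natural map `O(L_{2d}) → G_{2d}`, `f ↦ [f]`. -/
def toG2d (d : ℕ) : isometryGroup (gramL d) →* G2d d :=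
  (QuotientGroup.mk' (pmOne d)).comp (discHom d)

/-! The map `O(L_{2d}) → G_{2d}` is surjective. -/

def invE : Matrix (Fin 8) (Fin 8) ℤ :=
  !![-4, -5, -7, -10, -8, -6, -4, -2; -5, -8, -10, -15, -12, -9, -6, -3;
    -7, -10, -14, -20, -16, -12, -8, -4; -10, -15, -20, -30, -24, -18, -12, -6;
    -8, -12, -16, -24, -20, -15, -10, -5; -6, -9, -12, -18, -15, -12, -8, -4;
    -4, -6, -8, -12, -10, -8, -6, -3; -2, -3, -4, -6, -5, -4, -3, -2]

lemma invM_mul : osum gramU (osum gramU (osum invE invE)) * gramM = 1 := by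
  have hU : gramU * gramU = 1 := by decide
  have hE : invE * gramE = 1 := by decide
  simp [gramM, osum, Matrix.fromBlocks_multiply, hU, hE]

/-- The basis vector `k` of `L_{2d}`. -/
def vecK : IdxL → ℤ := Sum.elim (fun _ => 1) 0

lemma exists_of_mem_dualLattice {d : ℕ} [NeZero d] {x : IdxL → ℚ}
    (hx : x ∈ dualLattice (gramL d)) :
    ∃ (a : ℤ) (y : IdxM → ℤ), x = Sum.elim (fun _ => (a : ℚ) / (2 * d)) (vecCast ℚ y) := by
  have hd : (d : ℚ) ≠ 0 := Nat.cast_ne_zero.mpr (NeZero.ne d)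
  rw [mem_dualLattice] at hx
  obtain ⟨a, ha⟩ := hx vecK
  have h1 : ∀ i : IdxM, ∃ n : ℤ, ((gramM.map (Int.cast : ℤ → ℚ)) *ᵥ (x ∘ Sum.inr)) i = n := by
    intro i
    obtain ⟨n, hn⟩ := hx (Sum.elim 0 (Pi.single i 1))
    refine ⟨n, ?_⟩
    rw [form_comm ℚ (isSymm_gramL d), form_gramL] at hn
    rw [← hn]
    have e : (vecCast ℚ (Sum.elim 0 (Pi.single i 1) : IdxL → ℤ)) ∘ Sum.inr =
        (Pi.single i 1 : IdxM → ℚ) := by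
      ext j
      by_cases h : j = i
      · subst h; simp [vecCast]
      · simp [vecCast, h]
    rw [e, form, Matrix.toBilin'_apply']
    simp [vecCast]
  choose n hn using h1
  refine ⟨-a, (osum gramU (osum gramU (osum invE invE))) *ᵥ n, ?_⟩
  funext i
  rcases i with i | i
  · rw [form_gramL] at ha
    have e : (vecCast ℚ vecK) ∘ Sum.inr = (0 : IdxM → ℚ) := by ext; simp [vecCast, vecK]
    rw [e] at ha
    simp [vecCast, vecK] at ha
    simp only [Sum.elim_inl]
    push_cast
    rw [← ha]
    field_simp
  · simp only [Sum.elim_inr]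
    have h2 : (gramM.map (Int.castRingHom ℚ)) *ᵥ (x ∘ Sum.inr) = Int.castRingHom ℚ ∘ n := by
      funext j
      exact hn j
    have h3 := congrArg (fun A : Matrix IdxM IdxM ℤ => A.map (Int.castRingHom ℚ)) invM_mul
    simp only [Matrix.map_mul] at h3
    have h4 := RingHom.map_mulVec (Int.castRingHom ℚ)
      (osum gramU (osum gramU (osum invE invE))) n i
    rw [← h2, Matrix.mulVec_mulVec, h3] at h4
    simpa [vecCast] using h4.symm

lemma kdual_mem (d : ℕ) [NeZero d] :
    (Sum.elim (fun _ => 1 / (2 * (d : ℚ))) 0 : IdxL → ℚ) ∈ dualLattice (gramL d) := by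
  have hd : (d : ℚ) ≠ 0 := Nat.cast_ne_zero.mpr (NeZero.ne d)
  rw [mem_dualLattice]
  intro y
  refine ⟨-y (Sum.inl ()), ?_⟩
  rw [form_gramL]
  have e : (Sum.elim (fun _ => 1 / (2 * (d : ℚ))) 0 : IdxL → ℚ) ∘ Sum.inr = 0 := rfl
  rw [e]
  simp [vecCast]
  field_simp

/-- The class of `k / 2d`, a generator of the discriminant group. -/
def kappa (d : ℕ) [NeZero d] : Disc (gramL d) := Submodule.Quotient.mk ⟨_, kdual_mem d⟩

lemma exists_zsmul_kappa (d : ℕ) [NeZero d] (a : Disc (gramL d)) : ∃ n : ℤ, a = n • kappa d := by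
  obtain ⟨x, rfl⟩ := Submodule.Quotient.mk_surjective _ a
  obtain ⟨n, y, hx⟩ := exists_of_mem_dualLattice x.2
  refine ⟨n, ?_⟩
  rw [kappa, ← Submodule.Quotient.mk_smul, Submodule.Quotient.eq]
  refine ⟨Sum.elim 0 y, ?_⟩
  change _ = x.1 - n • _
  rw [hx]
  funext i
  rcases i with i | i
  · simp [vecCast]; ring
  · simp [vecCast]

lemma isoDisc_ext {d : ℕ} [NeZero d] {e f : isoDisc d}
    (h : e.1.val (kappa d) = f.1.val (kappa d)) : e = f := by
  apply Subtype.ext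
  apply Units.ext
  apply LinearMap.ext
  intro a
  obtain ⟨n, rfl⟩ := exists_zsmul_kappa d a
  rw [map_zsmul, map_zsmul, h]

/-- The element of `GL(ι, ℤ)` of an automorphism of `ℤ^ι`. -/
def ofEquiv {ι : Type*} [Fintype ι] [DecidableEq ι] (e : (ι → ℤ) ≃ₗ[ℤ] (ι → ℤ)) : GL ι ℤ :=
  Matrix.GeneralLinearGroup.toLin.symm (LinearMap.GeneralLinearGroup.ofLinearEquiv e)

lemma ofEquiv_mulVec {ι : Type*} [Fintype ι] [DecidableEq ι] (e : (ι → ℤ) ≃ₗ[ℤ] (ι → ℤ))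
    (x : ι → ℤ) : (ofEquiv e).val *ᵥ x = e x := by
  have h : (Matrix.GeneralLinearGroup.toLin (ofEquiv e)).val x = e x := by
    rw [ofEquiv, MulEquiv.apply_symm_apply]; rfl
  exact h

/-- An isometry of `⟨k⟩ ⊕ U` (extended by the identity), as a linear map. -/
def alMap (d g g' x x' : ℤ) : (IdxL → ℤ) →ₗ[ℤ] (IdxL → ℤ) where
  toFun v := Sum.elim
    (fun _ => (g * x + g' * x') * v (Sum.inl ()) + x * v (Sum.inr (Sum.inl 0)) +
      x' * v (Sum.inr (Sum.inl 1)))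
    (Sum.elim
      ![2 * d * v (Sum.inl ()) + g' * v (Sum.inr (Sum.inl 0)) + g * v (Sum.inr (Sum.inl 1)),
        2 * d * (x * x') * v (Sum.inl ()) + g * x ^ 2 * v (Sum.inr (Sum.inl 0)) +
          g' * x' ^ 2 * v (Sum.inr (Sum.inl 1))]
      (fun i => v (Sum.inr (Sum.inr i))))
  map_add' v w := by
    funext i
    rcases i with i | i | i
    · simp; ring
    · fin_cases i <;> simp <;> ring
    · simp
  map_smul' n v := by
    funext i
    rcases i with i | i | i
    · simp; ring
    · fin_cases i <;> simp <;> ring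
    · simp

/-- The inverse of `alMap`. -/
def alInv (d g g' x x' : ℤ) : (IdxL → ℤ) →ₗ[ℤ] (IdxL → ℤ) where
  toFun v := Sum.elim
    (fun _ => (g * x + g' * x') * v (Sum.inl ()) - x * x' * v (Sum.inr (Sum.inl 0)) -
      v (Sum.inr (Sum.inl 1)))
    (Sum.elim
      ![-(2 * d * x') * v (Sum.inl ()) + g' * x' ^ 2 * v (Sum.inr (Sum.inl 0)) +
          g * v (Sum.inr (Sum.inl 1)),
        -(2 * d * x) * v (Sum.inl ()) + g * x ^ 2 * v (Sum.inr (Sum.inl 0)) +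
          g' * v (Sum.inr (Sum.inl 1))]
      (fun i => v (Sum.inr (Sum.inr i))))
  map_add' v w := by
    funext i
    rcases i with i | i | i
    · simp; ring
    · fin_cases i <;> simp <;> ring
    · simp
  map_smul' n v := by
    funext i
    rcases i with i | i | i
    · simp; ring
    · fin_cases i <;> simp <;> ring
    · simp

/-- `alMap` as a linear equivalence. -/
def alEquiv {d g g' x x' : ℤ} (hd : d = g * g') (h : g * x - g' * x' = 1) :
    (IdxL → ℤ) ≃ₗ[ℤ] (IdxL → ℤ) :=
  LinearEquiv.ofLinearMap (alMap d g g' x x') (alInv d g g' x x')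
    (by
      subst hd
      apply LinearMap.ext
      intro v
      funext i
      have h2 : (g * x - g' * x') ^ 2 = 1 := by rw [h]; rfl
      rcases i with i | i | i
      · simp [alMap, alInv]
        linear_combination (v (Sum.inl ())) * h2
      · fin_cases i
        · simp [alMap, alInv]
          linear_combination (v (Sum.inr (Sum.inl 0))) * h2
        · simp [alMap, alInv]
          linear_combination (v (Sum.inr (Sum.inl 1))) * h2
      · simp [alMap, alInv])
    (by
      subst hd
      apply LinearMap.ext
      intro v
      funext i
      have h2 : (g * x - g' * x') ^ 2 = 1 := by rw [h]; rfl
      rcases i with i | i | i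
      · simp [alMap, alInv]
        linear_combination (v (Sum.inl ())) * h2
      · fin_cases i
        · simp [alMap, alInv]
          linear_combination (v (Sum.inr (Sum.inl 0))) * h2
        · simp [alMap, alInv]
          linear_combination (v (Sum.inr (Sum.inl 1))) * h2
      · simp [alMap, alInv])

lemma form_gramL_coord (d : ℕ) (v w : IdxL → ℤ) :
    form ℤ (gramL d) v w = -(2 * (d : ℤ)) * (v (Sum.inl ()) * w (Sum.inl ())) +
      (v (Sum.inr (Sum.inl 0)) * w (Sum.inr (Sum.inl 1)) +
        v (Sum.inr (Sum.inl 1)) * w (Sum.inr (Sum.inl 0))) +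
      form ℤ (osum gramU (osum gramE gramE)) (fun i => v (Sum.inr (Sum.inr i)))
        (fun i => w (Sum.inr (Sum.inr i))) := by
  rw [form_gramL, gramM, form_osum, form_gramU, ← add_assoc]
  rfl

lemma alEquiv_mem {d : ℕ} {g g' x x' : ℤ} (hd : (d : ℤ) = g * g') (h : g * x - g' * x' = 1) :
    ofEquiv (alEquiv hd h) ∈ isometryGroup (gramL d) := by
  intro v w
  have h2 : (g * x - g' * x') ^ 2 = 1 := by rw [h]; rfl
  rw [ofEquiv_mulVec, ofEquiv_mulVec, form_gramL_coord, form_gramL_coord]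
  simp only [alEquiv, LinearEquiv.coe_ofLinearMap, alMap, LinearMap.coe_mk, AddHom.coe_mk,
    Sum.elim_inl, Sum.elim_inr, Matrix.cons_val_zero, Matrix.cons_val_one]
  rw [hd]
  linear_combination (-(2 * (g * g')) * (v (Sum.inl ()) * w (Sum.inl ())) +
      (v (Sum.inr (Sum.inl 0)) * w (Sum.inr (Sum.inl 1)) +
        v (Sum.inr (Sum.inl 1)) * w (Sum.inr (Sum.inl 0)))) * h2

/-- If `f(k) = u k + 2d w`, then `f` acts on the discriminant group as multiplication by `u`. -/
lemma discHom_kappa {d : ℕ} [NeZero d] (f : isometryGroup (gramL d)) (u : ℤ) (w : IdxL → ℤ)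
    (h : f.1.val *ᵥ vecK = u • vecK + (2 * (d : ℤ)) • w) :
    (discHom d f).1.val (kappa d) = u • kappa d := by
  have hd : (d : ℚ) ≠ 0 := Nat.cast_ne_zero.mpr (NeZero.ne d)
  rw [kappa, discHom_mk, ← Submodule.Quotient.mk_smul, Submodule.Quotient.eq]
  refine ⟨w, ?_⟩
  have e : (Sum.elim (fun _ => 1 / (2 * (d : ℚ))) 0 : IdxL → ℚ) =
      (1 / (2 * (d : ℚ))) • vecCast ℚ vecK := by
    funext i
    rcases i with i | i <;> simp [vecCast, vecK]
  change vecCast ℚ w = (extend ℚ f.1).val (Sum.elim (fun _ => 1 / (2 * (d : ℚ))) 0) -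
    u • (Sum.elim (fun _ => 1 / (2 * (d : ℚ))) 0 : IdxL → ℚ)
  rw [e, map_smul, extend_vecCast, h]
  funext i
  simp [vecCast]
  field_simp
  ring

lemma discHom_surjective (d : ℕ) [NeZero d] : Function.Surjective (discHom d) := by
  intro e
  have hd : (d : ℚ) ≠ 0 := Nat.cast_ne_zero.mpr (NeZero.ne d)
  have hd' : (d : ℤ) ≠ 0 := Nat.cast_ne_zero.mpr (NeZero.ne d)
  obtain ⟨u, hu⟩ := exists_zsmul_kappa d (e.1.val (kappa d))
  have hq := e.2 (kappa d)
  rw [hu, kappa, ← Submodule.Quotient.mk_smul] at hq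
  change ((form ℚ (gramL d) (u • (Sum.elim (fun _ => 1 / (2 * (d : ℚ))) 0))
      (u • (Sum.elim (fun _ => 1 / (2 * (d : ℚ))) 0)) : ℚ) : AddCircle (2 : ℚ)) =
    ((form ℚ (gramL d) (Sum.elim (fun _ => 1 / (2 * (d : ℚ))) 0)
      (Sum.elim (fun _ => 1 / (2 * (d : ℚ))) 0) : ℚ) : AddCircle (2 : ℚ)) at hq
  rw [← sub_eq_zero, ← AddCircle.coe_sub, AddCircle.coe_eq_zero_iff] at hq
  obtain ⟨n, hn⟩ := hq
  have e0 : (Sum.elim (fun _ => 1 / (2 * (d : ℚ))) 0 : IdxL → ℚ) ∘ Sum.inr = 0 := rfl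
  rw [map_zsmul, map_zsmul, LinearMap.smul_apply, form_gramL, e0] at hn
  simp only [zsmul_eq_mul, map_zero, add_zero, Sum.elim_inl] at hn
  field_simp at hn
  have hn' : u ^ 2 - 1 = 4 * (d * (-n)) := by
    have : ((u : ℚ)) ^ 2 - 1 = 4 * (d * (-n)) := by linarith
    exact_mod_cast this
  have hodd : Odd u := by
    rw [← Int.not_even_iff_odd]
    rintro ⟨c, rfl⟩
    have : (1 : ℤ) = 4 * (c ^ 2 + d * n) := by linarith
    omega
  obtain ⟨B, rfl⟩ := hodd
  have hAB : (B + 1) * B = d * (-n) := by linarith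
  obtain ⟨g, g', ⟨x, hx⟩, ⟨x', hx'⟩, hg⟩ :=
    exists_dvd_and_dvd_of_dvd_mul (Dvd.intro _ hAB.symm)
  have h1 : g * x - g' * x' = 1 := by rw [← hx, ← hx']; ring
  refine ⟨⟨ofEquiv (alEquiv hg h1), alEquiv_mem hg h1⟩, isoDisc_ext ?_⟩
  rw [hu]
  refine discHom_kappa _ _ (Sum.elim 0 (Sum.elim ![1, x * x'] 0)) ?_
  rw [ofEquiv_mulVec]
  funext i
  rcases i with i | i | i
  · simp [alEquiv, alMap, vecK]
    linarith
  · fin_cases i <;> simp [alEquiv, alMap, vecK]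
  · simp [alEquiv, alMap, vecK]

lemma toG2d_surjective (d : ℕ) [NeZero d] : Function.Surjective (toG2d d) :=
  (QuotientGroup.mk'_surjective _).comp (discHom_surjective d)

/-! The polarisation vector `h`, and the stabiliser of `h` in the isometries of the K3 lattice. -/

/-- The primitive vector `h = e + d f` of the first hyperbolic plane of `Λ`; it has `h² = 2d`. -/
def vecH (d : ℕ) : IdxK3 → ℤ := Sum.elim ![1, (d : ℤ)] 0

/-- The embedding of `L_{2d}` in `Λ` with image `h^⊥`: it sends `k` to `e - d f` and is the
identity on `M`. -/
def embed (d : ℕ) : (IdxL → ℤ) →ₗ[ℤ] (IdxK3 → ℤ) where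
  toFun x := Sum.elim ![x (Sum.inl ()), -(d : ℤ) * x (Sum.inl ())] (fun i => x (Sum.inr i))
  map_add' x y := by
    funext i
    rcases i with i | i
    · fin_cases i <;> simp; ring
    · simp
  map_smul' n x := by
    funext i
    rcases i with i | i
    · fin_cases i <;> simp; ring
    · simp

lemma form_gramK3 (x y : IdxK3 → ℤ) :
    form ℤ gramK3 x y = x (Sum.inl 0) * y (Sum.inl 1) + x (Sum.inl 1) * y (Sum.inl 0) +
      form ℤ gramM (fun i => x (Sum.inr i)) (fun i => y (Sum.inr i)) := by
  rw [gramK3, form_osum, form_gramU]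
  rfl

lemma form_vecH (d : ℕ) : form ℤ gramK3 (vecH d) (vecH d) = 2 * d := by
  have e : (fun i => vecH d (Sum.inr i)) = 0 := rfl
  rw [form_gramK3, e]
  simp [vecH]
  ring

lemma form_embed (d : ℕ) (x y : IdxL → ℤ) :
    form ℤ gramK3 (embed d x) (embed d y) = form ℤ (gramL d) x y := by
  rw [form_gramK3, form_gramL]
  simp [embed]
  ring_nf
  rfl

lemma mem_range_embed (d : ℕ) (v : IdxK3 → ℤ) :
    v ∈ LinearMap.range (embed d) ↔ form ℤ gramK3 (vecH d) v = 0 := by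
  have e : (fun i => vecH d (Sum.inr i)) = 0 := rfl
  rw [form_gramK3, e]
  constructor
  · rintro ⟨x, rfl⟩
    simp [embed, vecH]
  · intro h
    simp [vecH] at h
    refine ⟨Sum.elim (fun _ => v (Sum.inl 0)) (fun i => v (Sum.inr i)), ?_⟩
    funext i
    rcases i with i | i
    · fin_cases i
      · simp [embed]
      · simp [embed]; linarith
    · simp [embed]

/-- `Γ_{2d}`: the isometries of `L_{2d} = h^⊥` that are restrictions of isometries of the K3
lattice fixing `h`. -/
def Gamma (d : ℕ) : Subgroup (isometryGroup (gramL d)) where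
  carrier := {g | ∃ γ ∈ isometryGroup gramK3, γ.val *ᵥ vecH d = vecH d ∧
    ∀ x, γ.val *ᵥ embed d x = embed d (g.1.val *ᵥ x)}
  mul_mem' {a b} := by
    rintro ⟨γ, hγ, h1, h2⟩ ⟨δ, hδ, h3, h4⟩
    refine ⟨γ * δ, mul_mem hγ hδ, ?_, fun x => ?_⟩
    · rw [Units.val_mul, ← Matrix.mulVec_mulVec, h3, h1]
    · rw [Units.val_mul, ← Matrix.mulVec_mulVec, h4, h2, Matrix.mulVec_mulVec]
      rfl
  one_mem' := ⟨1, one_mem _, by simp, fun x => by simp⟩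
  inv_mem' {a} := by
    rintro ⟨γ, hγ, h1, h2⟩
    refine ⟨γ⁻¹, inv_mem hγ, ?_, fun x => ?_⟩
    · conv_lhs => rw [← h1]
      rw [Matrix.mulVec_mulVec, ← Units.val_mul, inv_mul_cancel, Units.val_one,
        Matrix.one_mulVec]
    · have : x = a.1.val *ᵥ ((a⁻¹).1.val *ᵥ x) := by
        rw [Matrix.mulVec_mulVec, Subgroup.coe_inv, ← Units.val_mul, mul_inv_cancel,
          Units.val_one, Matrix.one_mulVec]
      conv_lhs => rw [this, ← h2]
      rw [Matrix.mulVec_mulVec, ← Units.val_mul, inv_mul_cancel, Units.val_one,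
        Matrix.one_mulVec]

/-! `Γ_{2d}` is the kernel of `Ψ`. -/

lemma exists_of_discHom_eq_one {d : ℕ} [NeZero d] {f : isometryGroup (gramL d)}
    (hf : discHom d f = 1) : ∃ w : IdxL → ℤ, f.1.val *ᵥ vecK = vecK + (2 * (d : ℤ)) • w := by
  have hd : (d : ℚ) ≠ 0 := Nat.cast_ne_zero.mpr (NeZero.ne d)
  have h : (discHom d f).1.val (kappa d) = kappa d := by rw [hf]; rfl
  rw [kappa, discHom_mk, Submodule.Quotient.eq] at h
  obtain ⟨w, hw⟩ := h
  have e : (Sum.elim (fun _ => 1 / (2 * (d : ℚ))) 0 : IdxL → ℚ) =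
      (1 / (2 * (d : ℚ))) • vecCast ℚ vecK := by
    funext i
    rcases i with i | i <;> simp [vecCast, vecK]
  change vecCast ℚ w = (extend ℚ f.1).val (Sum.elim (fun _ => 1 / (2 * (d : ℚ))) 0) -
    (Sum.elim (fun _ => 1 / (2 * (d : ℚ))) 0 : IdxL → ℚ) at hw
  rw [e, map_smul, extend_vecCast] at hw
  refine ⟨w, ?_⟩
  funext i
  have hi := congrFun hw i
  simp [vecCast] at hi
  field_simp at hi
  have : (((f.1.val *ᵥ vecK) i : ℤ) : ℚ) = ((vecK i + 2 * d * w i : ℤ) : ℚ) := by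
    push_cast
    linarith
  simpa using (Int.cast_injective this)

/-- The inclusion of `M` in `L_{2d}`. -/
abbrev incM (y : IdxM → ℤ) : IdxL → ℤ := Sum.elim 0 y

/-- The extension by `h ↦ h` of an endomorphism of `h^⊥` acting trivially on the discriminant. -/
def extMap (d : ℕ) (g : GL IdxL ℤ) (w : IdxL → ℤ) : (IdxK3 → ℤ) →ₗ[ℤ] (IdxK3 → ℤ) where
  toFun v := Sum.elim (fun j => v (Sum.inl j)) 0 +
    (d * v (Sum.inl 0) - v (Sum.inl 1)) • embed d w +
      embed d (g.val *ᵥ (incM (fun i => v (Sum.inr i))))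
  map_add' x y := by
    have e : (incM (fun i => (x + y) (Sum.inr i)) : IdxL → ℤ) =
        incM (fun i => x (Sum.inr i)) + incM (fun i => y (Sum.inr i)) := by
      funext i; rcases i with i | i <;> simp
    rw [e, Matrix.mulVec_add, map_add]
    funext i
    rcases i with i | i <;> simp <;> ring
  map_smul' n x := by
    have e : (incM (fun i => (n • x) (Sum.inr i)) : IdxL → ℤ) =
        n • incM (fun i => x (Sum.inr i)) := by
      funext i; rcases i with i | i <;> simp
    rw [e, Matrix.mulVec_smul, map_smul]
    funext i
    rcases i with i | i <;> simp <;> ring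

lemma extMap_vecH (d : ℕ) (g : GL IdxL ℤ) (w : IdxL → ℤ) :
    extMap d g w (vecH d) = vecH d := by
  have e : (incM (fun i => vecH d (Sum.inr i)) : IdxL → ℤ) = 0 := by
    funext i; rcases i with i | i <;> rfl
  simp only [extMap, LinearMap.coe_mk, AddHom.coe_mk, e, Matrix.mulVec_zero, map_zero, add_zero]
  funext i
  rcases i with i | i <;> simp [vecH]

lemma extMap_embed (d : ℕ) (g : GL IdxL ℤ) (w : IdxL → ℤ)
    (hg : g.val *ᵥ vecK = vecK + (2 * (d : ℤ)) • w) (x : IdxL → ℤ) :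
    extMap d g w (embed d x) = embed d (g.val *ᵥ x) := by
  have hx : x = x (Sum.inl ()) • vecK + incM (fun i => x (Sum.inr i)) := by
    funext i; rcases i with i | i <;> simp [vecK]
  have e : (incM (fun i => embed d x (Sum.inr i)) : IdxL → ℤ) =
      incM (fun i => x (Sum.inr i)) := by
    funext i; rcases i with i | i <;> simp [embed]
  have hk : (Sum.elim (fun j => embed d x (Sum.inl j)) 0 : IdxK3 → ℤ) =
      x (Sum.inl ()) • embed d vecK := by
    funext i
    rcases i with i | i
    · fin_cases i <;> simp [embed, vecK]; ring
    · simp [embed, vecK]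
  conv_rhs => rw [hx, Matrix.mulVec_add, Matrix.mulVec_smul, hg]
  simp only [extMap, LinearMap.coe_mk, AddHom.coe_mk, e, hk, map_add, map_smul]
  have e2 : (d : ℤ) * embed d x (Sum.inl 0) - embed d x (Sum.inl 1) =
      x (Sum.inl ()) * (2 * d) := by
    simp [embed]; ring
  rw [e2, smul_add, smul_smul]

lemma two_d_smul (d : ℕ) (v : IdxK3 → ℤ) :
    (2 * (d : ℤ)) • v = (d * v (Sum.inl 0) + v (Sum.inl 1)) • vecH d +
      embed d (Sum.elim (fun _ => d * v (Sum.inl 0) - v (Sum.inl 1))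
        (fun i => 2 * d * v (Sum.inr i))) := by
  funext i
  rcases i with i | i
  · fin_cases i <;> simp [embed, vecH] <;> ring
  · simp [embed, vecH]

lemma map_ext_K3 {d : ℕ} [NeZero d] {N : Type*} [AddCommGroup N] [Module.IsTorsionFree ℤ N]
    {S T : (IdxK3 → ℤ) →ₗ[ℤ] N} (h1 : S (vecH d) = T (vecH d))
    (h2 : ∀ x, S (embed d x) = T (embed d x)) : S = T := by
  have hd : (2 * (d : ℤ)) ≠ 0 := mul_ne_zero two_ne_zero (Nat.cast_ne_zero.mpr (NeZero.ne d))
  apply LinearMap.ext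
  intro v
  apply smul_right_injective N hd
  change (2 * (d : ℤ)) • S v = (2 * (d : ℤ)) • T v
  rw [← map_smul, ← map_smul, two_d_smul, map_add, map_add, map_smul, map_smul, h1, h2]

lemma mem_Gamma_of_discHom_eq_one {d : ℕ} [NeZero d] {f : isometryGroup (gramL d)}
    (hf : discHom d f = 1) : f ∈ Gamma d := by
  obtain ⟨w, hw⟩ := exists_of_discHom_eq_one hf
  obtain ⟨w', hw'⟩ := exists_of_discHom_eq_one (f := f⁻¹) (by rw [map_inv, hf, inv_one])
  have hE := extMap_embed d f.1 w hw
  have hE' := extMap_embed d (f⁻¹).1 w' hw'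
  let e : (IdxK3 → ℤ) ≃ₗ[ℤ] (IdxK3 → ℤ) :=
    LinearEquiv.ofLinearMap (extMap d f.1 w) (extMap d (f⁻¹).1 w')
      (map_ext_K3 (d := d) (by simp [extMap_vecH]) fun x => by
        rw [LinearMap.comp_apply, hE', hE, Matrix.mulVec_mulVec, ← Units.val_mul,
          ← Subgroup.coe_mul, mul_inv_cancel]
        simp)
      (map_ext_K3 (d := d) (by simp [extMap_vecH]) fun x => by
        rw [LinearMap.comp_apply, hE, hE', Matrix.mulVec_mulVec, ← Units.val_mul,
          ← Subgroup.coe_mul, inv_mul_cancel]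
        simp)
  have heH : e (vecH d) = vecH d := extMap_vecH _ _ _
  have heE : ∀ x, e (embed d x) = embed d (f.1.val *ᵥ x) := hE
  refine ⟨ofEquiv e, fun x y => ?_, by rw [ofEquiv_mulVec, heH],
    fun x => by rw [ofEquiv_mulVec, heE]⟩
  rw [ofEquiv_mulVec, ofEquiv_mulVec]
  have horth : ∀ x, form ℤ gramK3 (vecH d) (embed d x) = 0 :=
    fun x => (mem_range_embed d _).mp ⟨x, rfl⟩
  have hsymm : gramK3.IsSymm := by
    have hU : gramU.IsSymm := by ext i j; fin_cases i <;> fin_cases j <;> rfl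
    exact isSymm_osum hU isSymm_gramM
  have horth' : ∀ x, form ℤ gramK3 (embed d x) (vecH d) = 0 :=
    fun x => by rw [form_comm ℤ hsymm, horth]
  have key : (form ℤ gramK3).compl₁₂ e.toLinearMap e.toLinearMap = form ℤ gramK3 := by
    refine map_ext_K3 (d := d) ?_ fun x => ?_
    · refine map_ext_K3 (d := d) ?_ fun y => ?_
      · simp [heH]
      · simp [heH, heE, horth]
    · refine map_ext_K3 (d := d) ?_ fun y => ?_
      · simp [heH, heE, horth']
      · simp only [LinearMap.compl₁₂_apply, LinearEquiv.coe_coe, heE, form_embed]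
        exact f.2 x y
  exact LinearMap.congr_fun (LinearMap.congr_fun key x) y

lemma discHom_eq_one_of_mem_Gamma {d : ℕ} [NeZero d] {f : isometryGroup (gramL d)}
    (hf : f ∈ Gamma d) : discHom d f = 1 := by
  obtain ⟨γ, -, h1, h2⟩ := hf
  have hd : (2 * (d : ℤ)) ≠ 0 := mul_ne_zero two_ne_zero (Nat.cast_ne_zero.mpr (NeZero.ne d))
  set F : IdxK3 → ℤ := Sum.elim ![0, 1] 0 with hF
  have hk : embed d vecK = vecH d - (2 * (d : ℤ)) • F := by
    funext i
    rcases i with i | i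
    · fin_cases i <;> simp [embed, vecK, vecH, hF]; ring
    · simp [embed, vecK, vecH, hF]
  have h3 : embed d (f.1.val *ᵥ vecK - vecK) = (2 * (d : ℤ)) • (F - γ.val *ᵥ F) := by
    rw [map_sub, ← h2, hk, Matrix.mulVec_sub, h1, Matrix.mulVec_smul, smul_sub]
    abel
  refine isoDisc_ext ((discHom_kappa f 1 (Sum.elim (fun _ => (F - γ.val *ᵥ F) (Sum.inl 0))
    (fun i => (F - γ.val *ᵥ F) (Sum.inr i))) ?_).trans (one_smul _ _))
  rw [one_smul, ← sub_eq_iff_eq_add']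
  funext i
  rcases i with i | i
  · have := congrFun h3 (Sum.inl 0)
    simpa [embed] using this
  · have := congrFun h3 (Sum.inr i)
    simpa [embed] using this

lemma Gamma_eq_ker (d : ℕ) [NeZero d] : Gamma d = (discHom d).ker := by
  ext f
  exact ⟨discHom_eq_one_of_mem_Gamma, mem_Gamma_of_discHom_eq_one⟩

/-! Periods, the moduli space, and the action of `G_{2d}` on it. -/

instance : MulAction (GL IdxL ℤ) (ℙ ℂ (IdxL → ℂ)) :=
  MulAction.compHom _ (extend ℂ : GL IdxL ℤ →* LinearMap.GeneralLinearGroup ℂ (IdxL → ℂ))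

lemma smul_mk' (g : GL IdxL ℤ) (v : IdxL → ℂ) (hv : v ≠ 0) (hv' : (extend ℂ g).val v ≠ 0) :
    g • Projectivization.mk ℂ v hv = Projectivization.mk ℂ ((extend ℂ g).val v) hv' := rfl

/-- The period domain `D_{2d}`: the lines `σ` in `L_{2d} ⊗ ℂ` with `σ · σ = 0` and
`σ · σ̄ > 0`. -/
def periodDomain (d : ℕ) : Set (ℙ ℂ (IdxL → ℂ)) :=
  {σ | form ℂ (gramL d) σ.rep σ.rep = 0 ∧ 0 < (form ℂ (gramL d) σ.rep (star σ.rep)).re}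

lemma mk_mem_periodDomain {d : ℕ} {v : IdxL → ℂ} (hv : v ≠ 0) :
    Projectivization.mk ℂ v hv ∈ periodDomain d ↔
      form ℂ (gramL d) v v = 0 ∧ 0 < (form ℂ (gramL d) v (star v)).re := by
  obtain ⟨a, ha⟩ := Projectivization.exists_smul_eq_mk_rep ℂ v hv
  have ha0 : (a : ℂ) ≠ 0 := a.ne_zero
  have hpos : 0 < Complex.normSq a := Complex.normSq_pos.mpr ha0
  change form ℂ (gramL d) _ _ = 0 ∧ 0 < (form ℂ (gramL d) _ _).re ↔ _
  rw [← ha, Units.smul_def, star_smul, map_smul, map_smul, LinearMap.smul_apply,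
    LinearMap.smul_apply]
  have e : form ℂ (gramL d) v (star (a : ℂ) • star v) =
      star (a : ℂ) * form ℂ (gramL d) v (star v) := by rw [map_smul, smul_eq_mul]
  rw [e]
  simp only [smul_eq_mul]
  rw [← mul_assoc, ← mul_assoc, ← starRingEnd_apply, Complex.mul_conj,
    Complex.re_ofReal_mul]
  simp [ha0, hpos]

lemma star_extend (g : GL IdxL ℤ) (v : IdxL → ℂ) :
    star ((extend ℂ g).val v) = (extend ℂ g).val (star v) := by
  rw [extend_apply, extend_apply]
  funext i
  simp [Matrix.mulVec, dotProduct]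

lemma smul_mem_periodDomain {d : ℕ} (f : isometryGroup (gramL d)) {σ : ℙ ℂ (IdxL → ℂ)}
    (hσ : σ ∈ periodDomain d) : f.1 • σ ∈ periodDomain d := by
  induction σ using Projectivization.ind with
  | h v hv =>
    have hv' : (extend ℂ f.1).val v ≠ 0 := (smul_ne_zero_iff_ne (extend ℂ f.1)).mpr hv
    rw [smul_mk' _ _ _ hv', mk_mem_periodDomain, star_extend, form_extend ℂ f.2,
      form_extend ℂ f.2]
    exact (mk_mem_periodDomain hv).mp hσ

instance (d : ℕ) : MulAction (isometryGroup (gramL d)) (periodDomain d) where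
  smul f σ := ⟨f.1 • σ.1, smul_mem_periodDomain f σ.2⟩
  one_smul σ := Subtype.ext (one_smul (GL IdxL ℤ) σ.1)
  mul_smul f g σ := Subtype.ext (mul_smul f.1 g.1 σ.1)

/-- The moduli space `K_{2d} = D_{2d} / Γ_{2d}`. -/
abbrev Moduli (d : ℕ) : Type := MulAction.orbitRel.Quotient (Gamma d) (periodDomain d)

/-- The projection `D_{2d} → K_{2d}`, `σ ↦ [σ]`. -/
def toModuli (d : ℕ) (σ : periodDomain d) : Moduli d := Quotient.mk'' σ

lemma toModuli_eq_iff {d : ℕ} {σ τ : periodDomain d} :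
    toModuli d σ = toModuli d τ ↔ ∃ γ ∈ Gamma d, γ • τ = σ := by
  rw [toModuli, toModuli, Quotient.eq'', MulAction.orbitRel_apply, MulAction.mem_orbit_iff]
  exact ⟨fun ⟨γ, h⟩ => ⟨γ.1, γ.2, h⟩, fun ⟨γ, h, h'⟩ => ⟨⟨γ, h⟩, h'⟩⟩

/-- The isometry `- id` of `L_{2d}`. -/
def negIso (d : ℕ) : isometryGroup (gramL d) :=
  ⟨(-1 : GL IdxL ℤ), fun x y => by simp [Matrix.neg_mulVec]⟩

lemma negIso_smul (d : ℕ) (σ : periodDomain d) : negIso d • σ = σ := by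
  apply Subtype.ext
  obtain ⟨σ, hσ⟩ := σ
  change (-1 : GL IdxL ℤ) • σ = σ
  induction σ using Projectivization.ind with
  | h v hv =>
    have e : (extend ℂ (-1 : GL IdxL ℤ)).val v = -v := by
      rw [extend_apply]
      have : ((-1 : GL IdxL ℤ).val.map (Int.cast : ℤ → ℂ)) = -1 := by
        ext i j
        by_cases h : i = j
        · subst h; simp
        · simp [h]
      rw [this, Matrix.neg_mulVec, Matrix.one_mulVec]
    rw [smul_mk' _ _ _ (by rw [e]; exact neg_ne_zero.mpr hv), Projectivization.mk_eq_mk_iff']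
    exact ⟨-1, by rw [e, neg_one_smul]⟩

lemma discHom_negIso (d : ℕ) [NeZero d] : (discHom d (negIso d)).1 = -1 := by
  have h := discHom_kappa (negIso d) (-1) 0 (by simp [negIso, Matrix.neg_mulVec])
  apply Units.ext
  apply LinearMap.ext
  intro a
  obtain ⟨n, rfl⟩ := exists_zsmul_kappa d a
  rw [map_zsmul, map_zsmul, h]
  simp

lemma exists_Gamma_of_toG2d_eq_one {d : ℕ} [NeZero d] {f : isometryGroup (gramL d)}
    (hf : toG2d d f = 1) (σ : periodDomain d) : ∃ γ ∈ Gamma d, γ • σ = f • σ := by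
  have h : discHom d f ∈ pmOne d := (QuotientGroup.eq_one_iff _).mp hf
  rcases h with h | h
  · exact ⟨f, mem_Gamma_of_discHom_eq_one (Subtype.ext h), rfl⟩
  · refine ⟨f * negIso d, mem_Gamma_of_discHom_eq_one (Subtype.ext ?_), ?_⟩
    · rw [map_mul, Subgroup.coe_mul, h, discHom_negIso]
      simp
    · rw [mul_smul, negIso_smul]

lemma toModuli_smul_eq {d : ℕ} [NeZero d] {f f' : isometryGroup (gramL d)}
    (hf : toG2d d f = toG2d d f') {σ τ : periodDomain d}
    (h : toModuli d σ = toModuli d τ) : toModuli d (f • σ) = toModuli d (f' • τ) := by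
  obtain ⟨γ, hγ, rfl⟩ := toModuli_eq_iff.mp h
  have h1 : toG2d d γ = 1 := by
    change QuotientGroup.mk' _ (discHom d γ) = 1
    rw [discHom_eq_one_of_mem_Gamma hγ, map_one]
  obtain ⟨δ, hδ, h2⟩ := exists_Gamma_of_toG2d_eq_one (f := f * γ * f'⁻¹)
    (by rw [map_mul, map_mul, map_inv, h1, hf, mul_one, mul_inv_cancel]) (f' • τ)
  refine toModuli_eq_iff.mpr ⟨δ, hδ, ?_⟩
  rw [h2, ← mul_smul, inv_mul_cancel_right, mul_smul]

/-- The action of `G_{2d}` on `K_{2d}`: if `g = [f]` with `f ∈ O(L_{2d})`, then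
`g([σ]) = [f(σ)]`; see `toG2d_smul_toModuli`. -/
instance (d : ℕ) [NeZero d] : SMul (G2d d) (Moduli d) where
  smul g := Quotient.map' (fun σ => Function.surjInv (toG2d_surjective d) g • σ)
    fun _ _ h => Quotient.eq''.mp (toModuli_smul_eq rfl (Quotient.eq''.mpr h))

lemma toG2d_smul_toModuli (d : ℕ) [NeZero d] (f : isometryGroup (gramL d))
    (σ : periodDomain d) : toG2d d f • toModuli d σ = toModuli d (f • σ) :=
  toModuli_smul_eq (Function.surjInv_eq (toG2d_surjective d) _) rfl

instance (d : ℕ) [NeZero d] : MulAction (G2d d) (Moduli d) where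
  one_smul x := by
    obtain ⟨σ, rfl⟩ := Quotient.mk''_surjective x
    change (1 : G2d d) • toModuli d σ = toModuli d σ
    rw [← map_one (toG2d d), toG2d_smul_toModuli, one_smul]
  mul_smul g g' x := by
    obtain ⟨σ, rfl⟩ := Quotient.mk''_surjective x
    obtain ⟨f, rfl⟩ := toG2d_surjective d g
    obtain ⟨f', rfl⟩ := toG2d_surjective d g'
    change (toG2d d f * toG2d d f') • toModuli d σ = toG2d d f • toG2d d f' • toModuli d σ
    rw [← map_mul, toG2d_smul_toModuli, toG2d_smul_toModuli, toG2d_smul_toModuli, mul_smul]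

/-! Primitive sublattices, Heegner divisors and the set `ℜ`. -/

/-- A sublattice `L ⊆ ℤ^ι` is primitive if the quotient `ℤ^ι / L` is torsion free. -/
def IsPrimitiveSublattice {ι : Type*} (L : Submodule ℤ (ι → ℤ)) : Prop :=
  ∀ (n : ℤ) (x : ι → ℤ), n ≠ 0 → n • x ∈ L → x ∈ L

/-- The `R`-span `L ⊗ R ⊆ R^ι` of a sublattice `L ⊆ ℤ^ι`. -/
def scalarExt (R : Type*) [CommRing R] {ι : Type*} (L : Submodule ℤ (ι → ℤ)) :
    Submodule R (ι → R) :=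
  Submodule.span R (vecCast R '' L)

/-- The sublattice `L` of the lattice with Gram matrix `G` is non-degenerate of signature
`(p, n)`. -/
def HasSignature {ι : Type*} [Fintype ι] [DecidableEq ι] (G : Matrix ι ι ℤ)
    (L : Submodule ℤ (ι → ℤ)) (p n : ℕ) : Prop :=
  sigPos ((form ℝ G).toQuadraticMap.restrict (scalarExt ℝ L)) = p ∧
    sigNeg ((form ℝ G).toQuadraticMap.restrict (scalarExt ℝ L)) = n ∧
    Module.finrank ℝ (scalarExt ℝ L) = p + n

/-- `D_L = ℙ(L ⊗ ℂ) ∩ D_{2d}`. -/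
def subDomain (d : ℕ) (L : Submodule ℤ (IdxL → ℤ)) : Set (periodDomain d) :=
  {σ | σ.1.submodule ≤ scalarExt ℂ L}

/-- The Heegner divisor `H_L`, the image of `D_L` in `K_{2d}`. -/
def heegner (d : ℕ) (L : Submodule ℤ (IdxL → ℤ)) : Set (Moduli d) :=
  toModuli d '' subDomain d L

/-- The lattice `V(H_L)`, the orthogonal complement of `L` in `L_{2d}`. -/
def heegnerV (d : ℕ) (L : Submodule ℤ (IdxL → ℤ)) : Submodule ℤ (IdxL → ℤ) :=
  (form ℤ (gramL d)).orthogonal L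

/-- A vector of `ℤ^ι` is primitive if it is not a proper multiple of a vector. -/
def IsPrimitiveVector {ι : Type*} (v : ι → ℤ) : Prop :=
  ∀ (n : ℤ) (x : ι → ℤ), v = n • x → IsUnit n

/-- The set `ℜ` of the sublattices `⟨β⟩` of `L_{2d}`, where `β = α k + m j` with `j ∈ M` primitive
satisfies (a) `β` is primitive and `β²` divides `2m` and `2d`; (b) `β² < 0`, `β² ≠ -2` and
`β² ≠ -2d`. -/
def setR (d : ℕ) : Set (Submodule ℤ (IdxL → ℤ)) :=
  {V | ∃ (β : IdxL → ℤ) (α m : ℤ) (j : IdxM → ℤ),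
    V = Submodule.span ℤ {β} ∧ IsPrimitiveVector j ∧ β = Sum.elim (fun _ => α) (m • j) ∧
    (IsPrimitiveVector β ∧ form ℤ (gramL d) β β ∣ 2 * m ∧
      form ℤ (gramL d) β β ∣ 2 * (d : ℤ)) ∧
    (form ℤ (gramL d) β β < 0 ∧ form ℤ (gramL d) β β ≠ -2 ∧
      form ℤ (gramL d) β β ≠ -(2 * (d : ℤ)))}

end

end K3Period

open K3Period

/-!
The group `G_{2d}` acts through isometries `f` of `L_{2d}`, and `[f] = 1` exactly when `f` acts as
`± 1` on the discriminant group, which is cyclic of order `2d`, generated by `k / 2d`.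

Suppose that `[f]` fixes `H_L` pointwise. Then every `σ ∈ D_L` is an eigenvector of an isometry in
the coset `Γ_{2d} f`. There are only countably many isometries, each with finitely many eigenspaces,
and a Baire category argument (`exists_generic_isotropic`) produces a `σ ∈ D_L` outside all the
eigenspaces that do not contain `L ⊗ ℂ`. So some `h` with `[h] = [f]` is a scalar on `L`,
necessarily `± 1`, and after a change of sign it is the identity on `L`
(`HasSignature.exists_forall_mulVec_eq_self`). As `L_{2d}` has signature `(2, 19)`, the complement
of `L` is generated by a primitive vector `β` with `β² < 0`, and if `[h] ≠ 1` then `h` is the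
reflection `x ↦ x - (2 (x · β) / β²) β` (`HasSignature.eq_one_or_reflection`). Conversely, if this reflection
is integral, it fixes every point of `H_L`.

It remains to see for which `β = α k + m j` the reflection is integral with non-trivial class. Since
`M` is unimodular, integrality forces `β² ∣ 2m`; together with `gcd(α, m) = 1` and
`β² = -2dα² + m² j²` this gives `β² ∣ 2d`, and the two divisibilities suffice. The reflection
multiplies the discriminant group by `1 + 4dα² / β²` (`toG2d_reflection_eq_one_iff`), which is
`1` modulo `2d` precisely if `β² = -2`, and `-1` precisely if `β² = -2d`.
-/

namespace K3Period

noncomputable section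

/-! ### Signature of `L_{2d} ⊗ ℝ` and of its sublattices -/

lemma exists_mem_ne_zero_of_finrank_lt {K V W : Type*} [Field K] [AddCommGroup V] [Module K V]
    [AddCommGroup W] [Module K W] [FiniteDimensional K V] [FiniteDimensional K W]
    (P : Submodule K V) (f : V →ₗ[K] W) (h : Module.finrank K W < Module.finrank K P) :
    ∃ v ∈ P, v ≠ 0 ∧ f v = 0 := by
  obtain ⟨v, hv, hv0⟩ := Submodule.exists_mem_ne_zero_of_ne_bot
    (LinearMap.ker_ne_bot_of_finrank_lt (f := f.domRestrict P) h)
  exact ⟨v.1, v.2, fun h0 => hv0 (Subtype.ext h0), hv⟩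

/-- Completing squares along the branches of the Dynkin diagram shows that `E₈(-1)` is negative
definite. -/
lemma form_gramE_self (x : Fin 8 → ℝ) :
    form ℝ gramE x x =
      -2 * ((x 0 - x 2 / 2) ^ 2 + (x 1 - x 3 / 2) ^ 2 + 3 / 4 * (x 2 - 2 / 3 * x 3) ^ 2 +
        5 / 12 * (x 3 - 6 / 5 * x 4) ^ 2 + 2 / 5 * (x 4 - 5 / 4 * x 5) ^ 2 +
        3 / 8 * (x 5 - 4 / 3 * x 6) ^ 2 + 1 / 3 * (x 6 - 3 / 2 * x 7) ^ 2 +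
        1 / 4 * x 7 ^ 2) := by
  simp [form, gramE, CartanMatrix.E₈, Matrix.toBilin'_apply, Fin.sum_univ_eight]
  ring

lemma form_gramE_self_nonpos (x : Fin 8 → ℝ) : form ℝ gramE x x ≤ 0 := by
  rw [form_gramE_self]
  have : 0 ≤ (x 0 - x 2 / 2) ^ 2 + (x 1 - x 3 / 2) ^ 2 + 3 / 4 * (x 2 - 2 / 3 * x 3) ^ 2 +
        5 / 12 * (x 3 - 6 / 5 * x 4) ^ 2 + 2 / 5 * (x 4 - 5 / 4 * x 5) ^ 2 +
        3 / 8 * (x 5 - 4 / 3 * x 6) ^ 2 + 1 / 3 * (x 6 - 3 / 2 * x 7) ^ 2 +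
        1 / 4 * x 7 ^ 2 := by positivity
  linarith

lemma eq_zero_of_form_gramE_self_nonneg {x : Fin 8 → ℝ} (hx : 0 ≤ form ℝ gramE x x) : x = 0 := by
  have h := form_gramE_self x
  have p0 := sq_nonneg (x 0 - x 2 / 2)
  have p1 := sq_nonneg (x 1 - x 3 / 2)
  have p2 := sq_nonneg (x 2 - 2 / 3 * x 3)
  have p3 := sq_nonneg (x 3 - 6 / 5 * x 4)
  have p4 := sq_nonneg (x 4 - 5 / 4 * x 5)
  have p5 := sq_nonneg (x 5 - 4 / 3 * x 6)
  have p6 := sq_nonneg (x 6 - 3 / 2 * x 7)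
  have p7 := sq_nonneg (x 7)
  have h7 : x 7 = 0 := pow_eq_zero_iff two_ne_zero |>.mp (by linarith)
  have h6 : x 6 - 3 / 2 * x 7 = 0 := pow_eq_zero_iff two_ne_zero |>.mp (by linarith)
  have h5 : x 5 - 4 / 3 * x 6 = 0 := pow_eq_zero_iff two_ne_zero |>.mp (by linarith)
  have h4 : x 4 - 5 / 4 * x 5 = 0 := pow_eq_zero_iff two_ne_zero |>.mp (by linarith)
  have h3 : x 3 - 6 / 5 * x 4 = 0 := pow_eq_zero_iff two_ne_zero |>.mp (by linarith)
  have h2 : x 2 - 2 / 3 * x 3 = 0 := pow_eq_zero_iff two_ne_zero |>.mp (by linarith)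
  have h1 : x 1 - x 3 / 2 = 0 := pow_eq_zero_iff two_ne_zero |>.mp (by linarith)
  have h0 : x 0 - x 2 / 2 = 0 := pow_eq_zero_iff two_ne_zero |>.mp (by linarith)
  funext i
  fin_cases i <;> simp <;> linarith

/-- The pair of linear forms `x ↦ x · (e + f)` on the two hyperbolic planes of `L_{2d} ⊗ ℝ`; the
form is negative definite on their common kernel. -/
def positivePart : (IdxL → ℝ) →ₗ[ℝ] ℝ × ℝ where
  toFun v := (v (Sum.inr (Sum.inl 0)) + v (Sum.inr (Sum.inl 1)),
    v (Sum.inr (Sum.inr (Sum.inl 0))) + v (Sum.inr (Sum.inr (Sum.inl 1))))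
  map_add' v w := by ext <;> simp <;> ring
  map_smul' c v := by ext <;> simp <;> ring

lemma eq_zero_of_positivePart_eq_zero {d : ℕ} [NeZero d] {v : IdxL → ℝ}
    (hv : positivePart v = 0) (h : 0 ≤ form ℝ (gramL d) v v) : v = 0 := by
  have hd : (0 : ℝ) < d := Nat.cast_pos.mpr (Nat.pos_of_ne_zero (NeZero.ne d))
  have h0 : v (Sum.inr (Sum.inl 0)) + v (Sum.inr (Sum.inl 1)) = 0 := congrArg Prod.fst hv
  have h1 : v (Sum.inr (Sum.inr (Sum.inl 0))) + v (Sum.inr (Sum.inr (Sum.inl 1))) = 0 :=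
    congrArg Prod.snd hv
  rw [form_gramL, gramM, form_osum, form_osum, form_osum, form_gramU, form_gramU] at h
  simp only [Function.comp_apply] at h
  have n1 := form_gramE_self_nonpos ((((v ∘ Sum.inr) ∘ Sum.inr) ∘ Sum.inr) ∘ Sum.inl)
  have n2 := form_gramE_self_nonpos ((((v ∘ Sum.inr) ∘ Sum.inr) ∘ Sum.inr) ∘ Sum.inr)
  have e0 : v (Sum.inr (Sum.inl 1)) = -v (Sum.inr (Sum.inl 0)) := by linarith
  have e1 : v (Sum.inr (Sum.inr (Sum.inl 1))) = -v (Sum.inr (Sum.inr (Sum.inl 0))) := by linarith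
  rw [e0, e1] at h
  have pk : 0 ≤ (d : ℝ) * v (Sum.inl ()) ^ 2 := by positivity
  have p0 := sq_nonneg (v (Sum.inr (Sum.inl 0)))
  have p1 := sq_nonneg (v (Sum.inr (Sum.inr (Sum.inl 0))))
  have z1 := eq_zero_of_form_gramE_self_nonneg
    (x := (((v ∘ Sum.inr) ∘ Sum.inr) ∘ Sum.inr) ∘ Sum.inl) (by linarith)
  have z2 := eq_zero_of_form_gramE_self_nonneg
    (x := (((v ∘ Sum.inr) ∘ Sum.inr) ∘ Sum.inr) ∘ Sum.inr) (by linarith)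
  have zk : (d : ℝ) * v (Sum.inl ()) ^ 2 = 0 := by linarith
  have zk' : v (Sum.inl ()) = 0 := by
    rcases mul_eq_zero.mp zk with h | h
    · exact absurd h hd.ne'
    · exact pow_eq_zero_iff two_ne_zero |>.mp h
  have u0 : v (Sum.inr (Sum.inl 0)) = 0 := pow_eq_zero_iff two_ne_zero |>.mp (by linarith)
  have u1 : v (Sum.inr (Sum.inr (Sum.inl 0))) = 0 :=
    pow_eq_zero_iff two_ne_zero |>.mp (by linarith)
  funext i
  rcases i with i | i | i | i | i
  · exact zk'
  · fin_cases i
    · exact u0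
    · exact e0.trans (by rw [u0, neg_zero]; rfl)
  · fin_cases i
    · exact u1
    · exact e1.trans (by rw [u1, neg_zero]; rfl)
  · exact congrFun z1 i
  · exact congrFun z2 i

variable {d : ℕ} {L : Submodule ℤ (IdxL → ℤ)}

lemma HasSignature.exists_posDef (h : HasSignature (gramL d) L 2 18) :
    ∃ P : Submodule ℝ (IdxL → ℝ), P ≤ scalarExt ℝ L ∧ Module.finrank ℝ P = 2 ∧
      ∀ x ∈ P, x ≠ 0 → 0 < form ℝ (gramL d) x x := by
  obtain ⟨V, hV, hpos⟩ := exists_finrank_eq_sigPos_and_posDef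
    ((form ℝ (gramL d)).toQuadraticMap.restrict (scalarExt ℝ L))
  refine ⟨V.map (scalarExt ℝ L).subtype, ?_, ?_, ?_⟩
  · exact Submodule.map_subtype_le _ _
  · rw [Submodule.finrank_map_subtype_eq, hV, h.1]
  · rintro _ ⟨x, hx, rfl⟩ h0
    exact hpos ⟨x, hx⟩ fun h1 => h0 (congrArg (fun z => z.1.1) h1)

lemma HasSignature.exists_negDef (h : HasSignature (gramL d) L 2 18) :
    ∃ N : Submodule ℝ (IdxL → ℝ), N ≤ scalarExt ℝ L ∧ Module.finrank ℝ N = 18 ∧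
      ∀ x ∈ N, x ≠ 0 → form ℝ (gramL d) x x < 0 := by
  obtain ⟨V, hV, hneg⟩ := exists_finrank_eq_sigNeg_and_negDef
    ((form ℝ (gramL d)).toQuadraticMap.restrict (scalarExt ℝ L))
  refine ⟨V.map (scalarExt ℝ L).subtype, ?_, ?_, ?_⟩
  · exact Submodule.map_subtype_le _ _
  · rw [Submodule.finrank_map_subtype_eq, hV, h.2.1]
  · rintro _ ⟨x, hx, rfl⟩ h0
    have := hneg ⟨x, hx⟩ fun h1 => h0 (congrArg (fun z => z.1.1) h1)
    exact neg_pos.mp this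

/-- As `L_{2d}` has signature `(2, 19)`, vectors orthogonal to a sublattice of signature
`(2, 18)` are negative. -/
lemma HasSignature.form_self_neg [NeZero d] (h : HasSignature (gramL d) L 2 18) {v : IdxL → ℝ}
    (hv : ∀ x ∈ scalarExt ℝ L, form ℝ (gramL d) v x = 0) (h0 : v ≠ 0) :
    form ℝ (gramL d) v v < 0 := by
  by_contra! hvv
  obtain ⟨P, hPL, hP, hpos⟩ := h.exists_posDef
  -- On `P + ℝ v` the form is positive semidefinite, so this space misses the kernel of
  -- `positivePart`; hence it has dimension at most two.
  have hvP : v ∉ P := fun hvP => (hpos v hvP h0).ne' (hv v (hPL hvP))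
  have hlt : P < P ⊔ Submodule.span ℝ {v} := by
    refine lt_of_le_of_ne le_sup_left fun he => hvP ?_
    rw [he]
    exact Submodule.mem_sup_right (Submodule.mem_span_singleton_self v)
  have hrank := Submodule.finrank_lt_finrank_of_lt hlt
  obtain ⟨w, hw, hw0, hker⟩ := exists_mem_ne_zero_of_finrank_lt (P ⊔ Submodule.span ℝ {v})
    positivePart (by simpa [hP] using hrank)
  refine hw0 (eq_zero_of_positivePart_eq_zero (d := d) hker ?_)
  obtain ⟨p, hp, z, hz, rfl⟩ := Submodule.mem_sup.mp hw
  obtain ⟨c, rfl⟩ := Submodule.mem_span_singleton.mp hz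
  have h1 := hv p (hPL hp)
  have h2 : form ℝ (gramL d) p v = 0 := by rw [form_comm ℝ (isSymm_gramL d), h1]
  have h3 : 0 ≤ form ℝ (gramL d) p p := by
    by_cases hp0 : p = 0
    · simp [hp0]
    · exact (hpos p hp hp0).le
  simp only [map_add, map_smul, LinearMap.add_apply, LinearMap.smul_apply, h1, h2, smul_eq_mul]
  have h4 : 0 ≤ c * (c * form ℝ (gramL d) v v) := by
    rw [← mul_assoc]; exact mul_nonneg (mul_self_nonneg c) hvv
  linarith

/-- A real positive definite plane in `L ⊗ ℝ` has an orthogonal basis of vectors of equal norm: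
`x + i y` then spans a point of `D_L`. -/
lemma HasSignature.exists_period (h : HasSignature (gramL d) L 2 18) :
    ∃ x ∈ scalarExt ℝ L, ∃ y ∈ scalarExt ℝ L, form ℝ (gramL d) x y = 0 ∧
      0 < form ℝ (gramL d) x x ∧ form ℝ (gramL d) y y = form ℝ (gramL d) x x := by
  obtain ⟨P, hPL, hP, hpos⟩ := h.exists_posDef
  obtain ⟨x, hx, hx0⟩ := P.exists_mem_ne_zero_of_ne_bot (by
    rintro rfl
    simp at hP)
  obtain ⟨y, hy, hy0, hxy⟩ := exists_mem_ne_zero_of_finrank_lt P (form ℝ (gramL d) x)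
    (by rw [Module.finrank_self, hP]; norm_num)
  have hxx := hpos x hx hx0
  have hyy := hpos y hy hy0
  refine ⟨x, hPL hx, √(form ℝ (gramL d) x x / form ℝ (gramL d) y y) • y,
    (scalarExt ℝ L).smul_mem _ (hPL hy), ?_, hxx, ?_⟩
  · rw [map_smul, hxy, smul_zero]
  · rw [map_smul, map_smul, LinearMap.smul_apply, smul_eq_mul, smul_eq_mul, ← mul_assoc,
      Real.mul_self_sqrt (div_pos hxx hyy).le, div_mul_cancel₀ _ hyy.ne']

lemma HasSignature.exists_neg_orthogonal (h : HasSignature (gramL d) L 2 18)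
    (x y : IdxL → ℝ) : ∃ w ∈ scalarExt ℝ L, form ℝ (gramL d) w w < 0 ∧
      form ℝ (gramL d) x w = 0 ∧ form ℝ (gramL d) y w = 0 := by
  obtain ⟨N, hNL, hN, hneg⟩ := h.exists_negDef
  obtain ⟨w, hw, hw0, he⟩ := exists_mem_ne_zero_of_finrank_lt N
    ((form ℝ (gramL d) x).prod (form ℝ (gramL d) y)) (by simp [hN])
  exact ⟨w, hNL hw, hneg w hw hw0, congrArg Prod.fst he, congrArg Prod.snd he⟩

/-! ### Generic isotropic vectors -/

section Baire

variable {E : Type*} [NormedAddCommGroup E] [NormedSpace ℝ E] [FiniteDimensional ℝ E]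
  {ι : Type*} [Countable ι]

open Topology Filter in
/-- Countably many quadratic maps, none of them identically zero, have a common non-zero: the
complements of their zero sets are open and dense, so the Baire category theorem applies. -/
lemma exists_forall_apply_self_ne_zero (Q : ι → E →ₗ[ℝ] E →ₗ[ℝ] ℂ) (hQ : ∀ i, ∃ w, Q i w w ≠ 0) :
    ∃ w, ∀ i, Q i w w ≠ 0 := by
  have : CompleteSpace E := FiniteDimensional.complete ℝ E
  have hd : Dense (⋂ i, {w | Q i w w ≠ 0}) := by
    refine dense_iInter_of_isOpen (fun i => ?_) fun i a => ?_
    · have hc : Continuous fun w => (Q i).toContinuousBilinearMap w w := by fun_prop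
      exact isOpen_ne_fun hc continuous_const
    · obtain ⟨w, hw⟩ := hQ i
      by_contra ha
      -- If the map vanishes near `a`, then so do the coefficients of its restriction to the line
      -- from `a` to `w`, a polynomial of degree at most two; hence it vanishes at `w`.
      have hev : ∀ᶠ v in 𝓝 a, Q i v v = 0 := by
        filter_upwards [isClosed_closure.isOpen_compl.mem_nhds ha] with v hv
        by_contra hne
        exact hv (subset_closure hne)
      have hline : Tendsto (fun t : ℝ => a + t • (w - a)) (𝓝 0) (𝓝 a) := by
        have : Continuous fun t : ℝ => a + t • (w - a) := by fun_prop
        simpa using this.tendsto 0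
      obtain ⟨ε, hε, hball⟩ := Metric.eventually_nhds_iff.mp (hline.eventually hev)
      have h0 := hev.self_of_nhds
      have h1 := @hball (ε / 2) (by rw [Real.dist_0_eq_abs, abs_of_pos (by positivity)]; linarith)
      have h2 := @hball (-(ε / 2))
        (by rw [Real.dist_0_eq_abs, abs_neg, abs_of_pos (by positivity)]; linarith)
      have hε' : ε / 2 ≠ 0 := by positivity
      generalize ε / 2 = t at h1 h2 hε'
      have ht : (t : ℂ) ≠ 0 := Complex.ofReal_ne_zero.mpr hε'
      simp only [map_add, LinearMap.add_apply, map_smul, LinearMap.smul_apply, h0, zero_add,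
        Complex.real_smul, Complex.ofReal_neg] at h1 h2
      have hb : Q i (w - a) (w - a) = 0 := by
        have : (2 * (t * t)) * Q i (w - a) (w - a) = 0 := by linear_combination h1 + h2
        simpa [ht] using this
      have hm : Q i a (w - a) + Q i (w - a) a = 0 := by
        have : t * (Q i a (w - a) + Q i (w - a) a) = 0 := by
          linear_combination h1 - (t * t) * hb
        exact (mul_eq_zero.mp this).resolve_left ht
      refine hw ?_
      have : Q i w w = Q i a a + (Q i a (w - a) + Q i (w - a) a) + Q i (w - a) (w - a) := by
        simp only [map_sub, LinearMap.sub_apply]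
        abel
      rw [this, h0, hm, hb]
      simp
  obtain ⟨w, hw⟩ := hd.nonempty
  exact ⟨w, fun i => Set.mem_iInter.mp hw i⟩

/-- Given an orthogonal pair `x`, `y` of vectors of equal positive norm and a negative vector
orthogonal to both, there is another such pair for which `x + i y` avoids the kernels of countably
many given non-zero functionals. The new pair is, up to a factor, the image of the old one under the
reflection in a generic vector `w`, so that the conditions on `w` are quadratic; the negative vector
serves to show that none of them holds identically. -/
lemma exists_generic_isotropic (B : LinearMap.BilinForm ℝ E) (hB : ∀ v w, B v w = B w v)
    {x y : E} (hxy : B x y = 0) (hx : 0 < B x x) (hy : B y y = B x x)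
    (hneg : ∃ w, B w w < 0 ∧ B x w = 0 ∧ B y w = 0)
    (ψ : ι → E →ₗ[ℝ] ℂ) (hψ : ∀ i, ψ i ≠ 0) :
    ∃ x y : E, B x y = 0 ∧ 0 < B x x ∧ B y y = B x x ∧
      ∀ i, ψ i x + Complex.I * ψ i y ≠ 0 := by
  let s : E →ₗ[ℝ] ℂ := (LinearMap.toSpanSingleton ℝ ℂ 1).comp (B x) +
    (LinearMap.toSpanSingleton ℝ ℂ Complex.I).comp (B y)
  have hs : ∀ w, s w = B x w + B y w * Complex.I := fun w => by
    simp [s]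
  let Q : Option ι → E →ₗ[ℝ] E →ₗ[ℝ] ℂ := fun o => o.elim
    (B.compr₂ (LinearMap.toSpanSingleton ℝ ℂ 1)) fun i =>
      B.compr₂ (LinearMap.toSpanSingleton ℝ ℂ (ψ i x + Complex.I * ψ i y)) -
        (LinearMap.mul ℝ ℂ).compl₁₂ ((2 : ℝ) • s) (ψ i)
  have hQ0 : ∀ w, Q none w w = B w w := fun w => by simp [Q]
  have hQ1 : ∀ i w, Q (some i) w w =
      B w w * (ψ i x + Complex.I * ψ i y) - 2 * s w * ψ i w := fun i w => by
    simp [Q, mul_add]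
  obtain ⟨w, hw⟩ := exists_forall_apply_self_ne_zero Q <| by
    rintro (_ | i)
    · exact ⟨x, by rw [hQ0]; exact_mod_cast hx.ne'⟩
    · by_contra! h
      simp only [hQ1] at h
      obtain ⟨w, hw, hxw, hyw⟩ := hneg
      have hk : ψ i x + Complex.I * ψ i y = 0 := by
        have h1 := h w
        rw [hs, hxw, hyw] at h1
        have : (B w w : ℂ) ≠ 0 := by exact_mod_cast hw.ne
        simpa [this] using h1
      simp only [hk, mul_zero, zero_sub, neg_eq_zero, mul_assoc] at h
      have h' : ∀ w, s w * ψ i w = 0 := fun w => by simpa using h w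
      have hsx : s x = B x x := by rw [hs, hB y x, hxy]; simp
      have hsx0 : s x ≠ 0 := by rw [hsx]; exact_mod_cast hx.ne'
      have hψx : ψ i x = 0 := (mul_eq_zero.mp (h' x)).resolve_left hsx0
      refine hψ i (LinearMap.ext fun v => ?_)
      have h1 := h' (x + v)
      have h2 := h' (x - v)
      simp only [map_add, map_sub, hψx, zero_add, zero_sub] at h1 h2
      have h3 : s x * (2 * ψ i v) = 0 := by linear_combination h1 - h2
      simpa using (mul_eq_zero.mp h3).resolve_left hsx0
  have hw0 : B w w ≠ 0 := by
    have := hw none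
    rw [hQ0] at this
    exact_mod_cast this
  have hform : ∀ u v, B (B w w • u - (2 * B u w) • w) (B w w • v - (2 * B v w) • w) =
      B w w ^ 2 * B u v := fun u v => by
    simp only [map_sub, map_smul, LinearMap.sub_apply, LinearMap.smul_apply, smul_eq_mul, hB w v]
    ring
  refine ⟨B w w • x - (2 * B x w) • w, B w w • y - (2 * B y w) • w, ?_, ?_, ?_, fun i => ?_⟩
  · rw [hform, hxy, mul_zero]
  · rw [hform]
    positivity
  · rw [hform, hform, hy]
  · have h1 := hw (some i)
    rw [hQ1, hs] at h1
    convert h1 using 1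
    simp only [map_sub, map_smul, Complex.real_smul]
    push_cast
    ring

end Baire

/-! ### Isometries that fix a Heegner divisor -/

lemma vecCast_injective {R ι : Type*} [CommRing R] [CharZero R] :
    Function.Injective (vecCast R : (ι → ℤ) →ₗ[ℤ] ι → R) := fun _ _ h =>
  funext fun i => Int.cast_injective (congrFun h i)

/-- The inclusion of `L_{2d} ⊗ ℝ` in `L_{2d} ⊗ ℂ`. -/
def complexify : (IdxL → ℝ) →ₗ[ℝ] (IdxL → ℂ) where
  toFun x i := (x i : ℂ)
  map_add' x y := by ext i; simp
  map_smul' c x := by ext i; simp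

lemma complexify_vecCast (x : IdxL → ℤ) : complexify (vecCast ℝ x) = vecCast ℂ x := by
  ext i
  simp [complexify, vecCast]

lemma complexify_mem_scalarExt {L : Submodule ℤ (IdxL → ℤ)} {x : IdxL → ℝ}
    (hx : x ∈ scalarExt ℝ L) : complexify x ∈ scalarExt ℂ L := by
  induction hx using Submodule.span_induction with
  | mem x hx =>
    obtain ⟨y, hy, rfl⟩ := hx
    rw [complexify_vecCast]
    exact Submodule.subset_span ⟨y, hy, rfl⟩
  | zero => rw [map_zero]; exact zero_mem _
  | add x y _ _ hx hy => rw [map_add]; exact add_mem hx hy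
  | smul c x _ hx =>
    rw [map_smul]
    exact ((scalarExt ℂ L).restrictScalars ℝ).smul_mem c hx

lemma form_complexify (G : Matrix IdxL IdxL ℤ) (x y : IdxL → ℝ) :
    form ℂ G (complexify x) (complexify y) = form ℝ G x y := by
  simp only [form, Matrix.toBilin'_apply, complexify]
  simp

lemma star_complexify (x : IdxL → ℝ) : star (complexify x) = complexify x := by
  ext i
  simp [complexify]

lemma eq_zero_of_mem_scalarExt {R N : Type*} [CommRing R] [AddCommGroup N] [Module R N]
    {L : Submodule ℤ (IdxL → ℤ)} (φ : (IdxL → R) →ₗ[R] N) (h : ∀ x ∈ L, φ (vecCast R x) = 0)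
    {v : IdxL → R} (hv : v ∈ scalarExt R L) : φ v = 0 := by
  have hle : scalarExt R L ≤ LinearMap.ker φ := Submodule.span_le.mpr <| by
    rintro _ ⟨x, hx, rfl⟩
    exact h x hx
  exact hle hv

lemma extend_eq_self_of_mem_scalarExt {R : Type*} [CommRing R] {L : Submodule ℤ (IdxL → ℤ)}
    {h : GL IdxL ℤ} (hL : ∀ x ∈ L, h.val *ᵥ x = x) {v : IdxL → R} (hv : v ∈ scalarExt R L) :
    (extend R h).val v = v :=
  sub_eq_zero.mp <| eq_zero_of_mem_scalarExt ((extend R h).val - 1) (fun x hx => by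
    rw [LinearMap.sub_apply, extend_vecCast, hL x hx, Module.End.one_apply, sub_self]) hv

/-- There are period vectors in `L ⊗ ℂ` outside countably many given proper subspaces. -/
lemma HasSignature.exists_generic_period (h : HasSignature (gramL d) L 2 18) {ι : Type*}
    [Countable ι] (F : ι → (IdxL → ℂ) →ₗ[ℂ] ℂ) (hF : ∀ i, ∃ x ∈ scalarExt ℂ L, F i x ≠ 0) :
    ∃ v ∈ scalarExt ℂ L, form ℂ (gramL d) v v = 0 ∧ 0 < (form ℂ (gramL d) v (star v)).re ∧
      ∀ i, F i v ≠ 0 := by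
  obtain ⟨x₀, hx₀, y₀, hy₀, hxy₀, hpos₀, heq₀⟩ := h.exists_period
  obtain ⟨w, hw, hww, hxw, hyw⟩ := h.exists_neg_orthogonal x₀ y₀
  obtain ⟨⟨x, hx⟩, ⟨y, hy⟩, hxy, hpos, heq, hne⟩ :=
    exists_generic_isotropic ((form ℝ (gramL d)).restrict (scalarExt ℝ L))
    (fun v w => form_comm ℝ (isSymm_gramL d) v.1 w.1) (x := ⟨x₀, hx₀⟩) (y := ⟨y₀, hy₀⟩) hxy₀ hpos₀
    heq₀ ⟨⟨w, hw⟩, hww, hxw, hyw⟩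
    (fun i => ((F i).restrictScalars ℝ ∘ₗ complexify) ∘ₗ (scalarExt ℝ L).subtype) (fun i h0 => by
      obtain ⟨z, hz, hne⟩ := hF i
      refine hne (eq_zero_of_mem_scalarExt (F i) (fun l hl => ?_) hz)
      rw [← complexify_vecCast]
      exact LinearMap.congr_fun h0 ⟨vecCast ℝ l, Submodule.subset_span ⟨l, hl, rfl⟩⟩)
  replace hxy : form ℝ (gramL d) x y = 0 := hxy
  replace hpos : 0 < form ℝ (gramL d) x x := hpos
  replace heq : form ℝ (gramL d) y y = form ℝ (gramL d) x x := heq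
  have hyx : form ℝ (gramL d) y x = 0 := by rw [form_comm ℝ (isSymm_gramL d), hxy]
  refine ⟨complexify x + Complex.I • complexify y, add_mem (complexify_mem_scalarExt hx)
    (Submodule.smul_mem _ _ (complexify_mem_scalarExt hy)), ?_, ?_, fun i => ?_⟩
  · simp only [map_add, map_smul, LinearMap.add_apply, LinearMap.smul_apply, form_complexify,
      hxy, hyx, heq, smul_eq_mul, Complex.ofReal_zero]
    linear_combination (form ℝ (gramL d) x x : ℂ) * Complex.I_mul_I
  · rw [star_add, star_smul, star_complexify, star_complexify, Complex.star_def, Complex.conj_I]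
    simp only [map_add, map_smul, LinearMap.add_apply, LinearMap.smul_apply, form_complexify,
      hxy, hyx, heq, smul_eq_mul]
    simp
    exact hpos
  · rw [map_add, map_smul]
    exact hne i

instance : Countable (isometryGroup (gramL d)) := by
  have : Countable (Matrix IdxL IdxL ℤ) := inferInstanceAs (Countable (IdxL → IdxL → ℤ))
  exact Function.Injective.countable (f := fun g : isometryGroup (gramL d) => g.1.val)
    fun _ _ h => Subtype.ext (Units.ext h)

/-- If `[f]` fixes `H_L` pointwise, then some `h` with `[h] = [f]` acts on `L ⊗ ℂ` by a scalar: a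
very general `σ ∈ D_L` is not an eigenvector of any `h` in the countable group `O(L_{2d})` unless `L ⊗ ℂ`
is contained in an eigenspace of `h`. -/
lemma HasSignature.exists_extend_eq_smul [NeZero d] (hsig : HasSignature (gramL d) L 2 18)
    {f : isometryGroup (gramL d)}
    (hf : heegner d L ⊆ MulAction.fixedBy (Moduli d) (toG2d d f)) :
    ∃ h : isometryGroup (gramL d), toG2d d h = toG2d d f ∧
      ∃ c : ℂ, ∀ x ∈ scalarExt ℂ L, (extend ℂ h.1).val x = c • x := by
  let T (h : isometryGroup (gramL d)) : Module.End ℂ (IdxL → ℂ) := (extend ℂ h.1).val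
  have : ∀ h, Countable {c // (T h).HasEigenvalue c} := fun h =>
    (T h).finite_hasEigenvalue.countable
  let F (p : (Σ h, {c // (T h).HasEigenvalue c}) × IdxL) : (IdxL → ℂ) →ₗ[ℂ] ℂ :=
    LinearMap.proj p.2 ∘ₗ (T p.1.1 - (p.1.2 : ℂ) • 1)
  obtain ⟨v, hvL, hvv, hpos, hgen⟩ := hsig.exists_generic_period
    (fun p : {p // ∃ x ∈ scalarExt ℂ L, F p x ≠ 0} => F p.1) fun p => p.2
  have hv0 : v ≠ 0 := by
    rintro rfl
    simp at hpos
  let σ : periodDomain d := ⟨Projectivization.mk ℂ v hv0, (mk_mem_periodDomain hv0).mpr ⟨hvv, hpos⟩⟩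
  have hσ : σ ∈ subDomain d L := by
    change (Projectivization.mk ℂ v hv0).submodule ≤ _
    rw [Projectivization.submodule_mk]
    exact (Submodule.span_singleton_le_iff_mem _ _).mpr hvL
  have hfix := hf ⟨σ, hσ, rfl⟩
  rw [MulAction.mem_fixedBy, toG2d_smul_toModuli, toModuli_eq_iff] at hfix
  obtain ⟨γ, hγ, hγσ⟩ := hfix
  have hγ1 : toG2d d γ = 1 := by
    change QuotientGroup.mk' _ (discHom d γ) = 1
    rw [discHom_eq_one_of_mem_Gamma hγ, map_one]
  refine ⟨γ⁻¹ * f, by rw [map_mul, map_inv, hγ1, inv_one, one_mul], ?_⟩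
  have hhσ : (γ⁻¹ * f) • σ = σ := by rw [mul_smul, ← hγσ, inv_smul_smul]
  generalize γ⁻¹ * f = h at hhσ
  have hTv0 : T h v ≠ 0 := (smul_ne_zero_iff_ne (extend ℂ h.1)).mpr hv0
  obtain ⟨c, hc⟩ := (Projectivization.mk_eq_mk_iff' ℂ _ _ hTv0 hv0).mp (congrArg Subtype.val hhσ)
  have hev : (T h).HasEigenvalue c :=
    Module.End.hasEigenvalue_of_hasEigenvector
      (Module.End.hasEigenvector_iff.mpr ⟨Module.End.mem_eigenspace_iff.mpr hc.symm, hv0⟩)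
  refine ⟨c, fun x hx => sub_eq_zero.mp (funext fun i => ?_)⟩
  by_contra hne
  refine hgen ⟨(⟨h, c, hev⟩, i), x, hx, hne⟩ ?_
  change (T h v - c • v) i = 0
  rw [hc, sub_self, Pi.zero_apply]

/-- The scalar by which an isometry acts on `L` is a sign, since `L` contains vectors of non-zero
norm. -/
lemma HasSignature.exists_mulVec_eq_smul [NeZero d] (hsig : HasSignature (gramL d) L 2 18)
    {h : isometryGroup (gramL d)} {c : ℂ}
    (hc : ∀ x ∈ scalarExt ℂ L, (extend ℂ h.1).val x = c • x) :
    (∀ x ∈ L, h.1.val *ᵥ x = x) ∨ ∀ x ∈ L, h.1.val *ᵥ x = -x := by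
  have hint : ∀ x ∈ L, vecCast ℂ (h.1.val *ᵥ x) = c • vecCast ℂ x := fun x hx => by
    rw [← extend_vecCast]
    exact hc _ (Submodule.subset_span ⟨x, hx, rfl⟩)
  have hc2 : c * c = 1 := by
    by_contra hne
    have h0 : ∀ x ∈ L, ∀ y ∈ L, form ℤ (gramL d) x y = 0 := fun x hx y hy => by
      have h1 := congrArg (Int.cast : ℤ → ℂ) (h.2 x y)
      rw [← form_vecCast, ← form_vecCast, hint x hx, hint y hy, map_smul, map_smul,
        LinearMap.smul_apply, smul_eq_mul, smul_eq_mul, form_vecCast] at h1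
      have h2 : (c * c - 1) * (form ℤ (gramL d) x y : ℂ) = 0 := by linear_combination h1
      exact_mod_cast (mul_eq_zero.mp h2).resolve_left (sub_ne_zero.mpr hne)
    obtain ⟨x, hx, -, -, -, hpos, -⟩ := hsig.exists_period
    refine hpos.ne' (eq_zero_of_mem_scalarExt _ (fun y hy => ?_) hx)
    rw [form_comm ℝ (isSymm_gramL d)]
    refine eq_zero_of_mem_scalarExt _ (fun z hz => ?_) hx
    rw [form_vecCast, h0 y hy z hz, Int.cast_zero]
  rcases mul_self_eq_one_iff.mp hc2 with rfl | rfl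
  · exact Or.inl fun x hx => vecCast_injective (by rw [hint x hx, one_smul])
  · exact Or.inr fun x hx => vecCast_injective (by rw [hint x hx, neg_one_smul, map_neg])

/-! ### The orthogonal complement of `L` -/

section Primitive

variable {ι : Type*}

lemma exists_eq_smul_isPrimitiveVector [Fintype ι] [Nonempty ι] (y : ι → ℤ) :
    ∃ (m : ℤ) (j : ι → ℤ), IsPrimitiveVector j ∧ y = m • j := by
  obtain ⟨j, hj, hgcd⟩ := Finset.extract_gcd y Finset.univ_nonempty
  refine ⟨Finset.univ.gcd y, j, fun n x hx => isUnit_of_dvd_one ?_, funext fun i => ?_⟩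
  · rw [← hgcd]
    exact Finset.dvd_gcd fun i _ => ⟨x i, congrFun hx i⟩
  · exact hj i (Finset.mem_univ i)

lemma IsPrimitiveVector.exists_dotProduct_eq_one [Fintype ι] {v : ι → ℤ}
    (hv : IsPrimitiveVector v) :
    ∃ u : ι → ℤ, u ⬝ᵥ v = 1 := by
  set I : Ideal ℤ := Ideal.span (Set.range v)
  have hdvd : ∀ i, Submodule.IsPrincipal.generator I ∣ v i := fun i =>
    (Submodule.IsPrincipal.mem_iff_generator_dvd I).mp (Ideal.subset_span ⟨i, rfl⟩)
  choose x hx using hdvd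
  have hI : I = ⊤ := Ideal.eq_top_of_isUnit_mem _ (Submodule.IsPrincipal.generator_mem I)
    (hv _ x (funext hx))
  exact Ideal.mem_span_range_iff_exists_fun.mp ((Ideal.eq_top_iff_one I).mp hI)

lemma IsPrimitiveVector.isCoprime {α m : ℤ} {j : ι → ℤ}
    (h : IsPrimitiveVector (Sum.elim (fun _ => α) (m • j) : Unit ⊕ ι → ℤ)) : IsCoprime α m := by
  rw [Int.isCoprime_iff_gcd_eq_one]
  obtain ⟨a, ha⟩ := Int.gcd_dvd_left α m
  obtain ⟨b, hb⟩ := Int.gcd_dvd_right α m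
  have := h (Int.gcd α m) (Sum.elim (fun _ => a) (b • j)) <| by
    funext i
    rcases i with i | i
    · exact ha
    · simp only [Sum.elim_inr, Pi.smul_apply, smul_eq_mul]
      rw [← mul_assoc, ← hb]
  rwa [Int.ofNat_isUnit, Nat.isUnit_iff] at this

end Primitive

lemma exists_form_gramM_eq_one {j : IdxM → ℤ} (hj : IsPrimitiveVector j) :
    ∃ x : IdxM → ℤ, form ℤ gramM j x = 1 := by
  obtain ⟨u, hu⟩ := hj.exists_dotProduct_eq_one
  refine ⟨osum gramU (osum gramU (osum invE invE)) *ᵥ u, ?_⟩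
  have e : gramM.map (Int.cast : ℤ → ℤ) = gramM := by ext; simp
  rw [form, Matrix.toBilin'_apply', e, Matrix.mulVec_mulVec, mul_eq_one_comm.mp invM_mul,
    Matrix.one_mulVec, dotProduct_comm, hu]

lemma mem_heegnerV {v : IdxL → ℤ} :
    v ∈ heegnerV d L ↔ ∀ x ∈ L, form ℤ (gramL d) v x = 0 := by
  rw [heegnerV, LinearMap.BilinForm.mem_orthogonal_iff]
  exact forall₂_congr fun x _ => by rw [form_comm ℤ (isSymm_gramL d)]

lemma form_eq_zero_of_mem_heegnerV {v : IdxL → ℤ} (hv : v ∈ heegnerV d L) :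
    ∀ x ∈ scalarExt ℝ L, form ℝ (gramL d) (vecCast ℝ v) x = 0 := fun _ hx =>
  eq_zero_of_mem_scalarExt _ (fun x hx => by
    rw [form_vecCast, mem_heegnerV.mp hv x hx, Int.cast_zero]) hx

lemma scalarExt_real_eq_top (h : scalarExt ℚ L = ⊤) : scalarExt ℝ L = ⊤ := by
  let C : (IdxL → ℚ) →ₗ[ℚ] IdxL → ℝ := (Algebra.linearMap ℚ ℝ).compLeft IdxL
  have hle : scalarExt ℚ L ≤ ((scalarExt ℝ L).restrictScalars ℚ).comap C :=
    Submodule.span_le.mpr <| by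
      rintro _ ⟨x, hx, rfl⟩
      refine Submodule.subset_span ⟨x, hx, ?_⟩
      funext i
      simp [C, vecCast]
  rw [eq_top_iff, ← (Pi.basisFun ℝ IdxL).span_eq, Submodule.span_le]
  rintro _ ⟨i, rfl⟩
  have := hle (h ▸ Submodule.mem_top : (Pi.single i 1 : IdxL → ℚ) ∈ scalarExt ℚ L)
  have e : C (Pi.single i 1) = Pi.single i 1 := by
    funext k
    by_cases hk : k = i
    · subst hk; simp [C]
    · simp [C, hk]
  rw [Pi.basisFun_apply, ← e]
  exact this

lemma finrank_idxL (K : Type*) [Field K] : Module.finrank K (IdxL → K) = 21 := by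
  rw [Module.finrank_fintype_fun_eq_card]
  rfl

lemma HasSignature.exists_ne_zero_mem_heegnerV (h : HasSignature (gramL d) L 2 18) :
    ∃ v ∈ heegnerV d L, v ≠ 0 := by
  have hlt : Module.finrank ℚ (scalarExt ℚ L) < Module.finrank ℚ (IdxL → ℚ) := by
    refine Submodule.finrank_lt fun htop => ?_
    have := h.2.2
    rw [scalarExt_real_eq_top htop, finrank_top, finrank_idxL] at this
    omega
  obtain ⟨v, -, hv0, hv⟩ := exists_mem_ne_zero_of_finrank_lt ⊤
    ((scalarExt ℚ L).subtype.dualMap ∘ₗ form ℚ (gramL d))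
    (by rwa [finrank_top, Subspace.dual_finrank_eq])
  obtain ⟨b, hb⟩ := IsLocalization.exist_integer_multiples_of_finite (nonZeroDivisors ℤ) v
  choose w hw using hb
  have hb0 : ((b : ℤ) : ℚ) ≠ 0 := Int.cast_ne_zero.mpr (nonZeroDivisors.coe_ne_zero b)
  have hwv : vecCast ℚ w = ((b : ℤ) : ℚ) • v := funext fun i => by
    simpa [vecCast] using hw i
  refine ⟨w, mem_heegnerV.mpr fun x hx => ?_, ?_⟩
  · have h1 : form ℚ (gramL d) v (vecCast ℚ x) = 0 :=
      LinearMap.congr_fun hv ⟨vecCast ℚ x, Submodule.subset_span ⟨x, hx, rfl⟩⟩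
    have h2 := form_vecCast ℚ (gramL d) w x
    rw [hwv, map_smul, LinearMap.smul_apply, h1, smul_zero] at h2
    exact_mod_cast h2.symm
  · rintro rfl
    rw [map_zero] at hwv
    exact hv0 ((smul_eq_zero.mp hwv.symm).resolve_left hb0)

/-- By a dimension count, `L ⊗ ℝ` is the full orthogonal complement of any non-zero vector
orthogonal to it. -/
lemma HasSignature.mem_scalarExt_of_form_eq_zero [NeZero d] (h : HasSignature (gramL d) L 2 18)
    {v : IdxL → ℝ} (hv : ∀ x ∈ scalarExt ℝ L, form ℝ (gramL d) v x = 0) (h0 : v ≠ 0)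
    {w : IdxL → ℝ} (hw : form ℝ (gramL d) v w = 0) : w ∈ scalarExt ℝ L := by
  have hne : form ℝ (gramL d) v ≠ 0 := fun h1 =>
    (h.form_self_neg hv h0).ne (by rw [h1, LinearMap.zero_apply])
  have hker := Module.Dual.finrank_ker_add_one_of_ne_zero hne
  rw [finrank_idxL] at hker
  have heq : scalarExt ℝ L = LinearMap.ker (form ℝ (gramL d) v) :=
    Submodule.eq_of_le_of_finrank_eq hv (by rw [h.2.2]; omega)
  rw [heq]
  exact hw

/-- The orthogonal complement of a sublattice of signature `(2, 18)` in `L_{2d}` is generated by a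
primitive vector of negative norm. -/
lemma HasSignature.exists_heegnerV_eq_span [NeZero d] (h : HasSignature (gramL d) L 2 18) :
    ∃ β, IsPrimitiveVector β ∧ heegnerV d L = Submodule.span ℤ {β} ∧
      form ℤ (gramL d) β β < 0 := by
  obtain ⟨v, hv, hv0⟩ := h.exists_ne_zero_mem_heegnerV
  obtain ⟨m, β, hβ, rfl⟩ := exists_eq_smul_isPrimitiveVector v
  have hm : m ≠ 0 := fun hm => hv0 (by rw [hm, zero_smul])
  have hβV : β ∈ heegnerV d L := mem_heegnerV.mpr fun x hx => by
    have := mem_heegnerV.mp hv x hx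
    rw [map_smul, LinearMap.smul_apply, smul_eq_mul] at this
    exact (mul_eq_zero.mp this).resolve_left hm
  have hβ0 : vecCast ℝ β ≠ 0 := fun h0 => by
    rw [← map_zero (vecCast ℝ)] at h0
    exact hv0 (by rw [vecCast_injective h0, smul_zero])
  have hneg := h.form_self_neg (form_eq_zero_of_mem_heegnerV hβV) hβ0
  refine ⟨β, hβ, le_antisymm (fun w hw => ?_) ?_, ?_⟩
  · obtain ⟨u, hu⟩ := hβ.exists_dotProduct_eq_one
    set r := form ℝ (gramL d) (vecCast ℝ β) (vecCast ℝ w) /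
      form ℝ (gramL d) (vecCast ℝ β) (vecCast ℝ β) with hr
    -- The component `z` of `w` orthogonal to `β` is both in `L ⊗ ℝ` and orthogonal to it; so it is
    -- isotropic, hence zero.
    have hz : vecCast ℝ w - r • vecCast ℝ β = 0 := by
      by_contra hne
      have hzL : ∀ x ∈ scalarExt ℝ L,
          form ℝ (gramL d) (vecCast ℝ w - r • vecCast ℝ β) x = 0 := fun x hx => by
        rw [map_sub, map_smul, LinearMap.sub_apply, LinearMap.smul_apply,
          form_eq_zero_of_mem_heegnerV hw x hx, form_eq_zero_of_mem_heegnerV hβV x hx,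
          smul_zero, sub_zero]
      refine (h.form_self_neg hzL hne).ne (hzL _ ?_)
      refine h.mem_scalarExt_of_form_eq_zero (form_eq_zero_of_mem_heegnerV hβV) hβ0 ?_
      rw [map_sub, map_smul, smul_eq_mul, hr, div_mul_cancel₀ _ hneg.ne, sub_self]
    have hw' : ∀ i, (w i : ℝ) = r * β i := fun i => sub_eq_zero.mp (congrFun hz i)
    have hur : ((u ⬝ᵥ w : ℤ) : ℝ) = r := by
      have hu' : ((u ⬝ᵥ β : ℤ) : ℝ) = 1 := by rw [hu, Int.cast_one]
      rw [← mul_one r, ← hu']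
      simp only [dotProduct, Int.cast_sum, Int.cast_mul, Finset.mul_sum, hw']
      exact Finset.sum_congr rfl fun i _ => by ring
    refine Submodule.mem_span_singleton.mpr ⟨u ⬝ᵥ w, funext fun i => ?_⟩
    have : (((u ⬝ᵥ w) * β i : ℤ) : ℝ) = w i := by rw [Int.cast_mul, hur, hw']
    exact_mod_cast this
  · exact (Submodule.span_singleton_le_iff_mem _ _).mpr hβV
  · rw [form_vecCast] at hneg
    exact_mod_cast hneg

/-- An isometry that fixes `L` pointwise is the identity or the reflection in a generator of
`V(H_L)`. -/
lemma HasSignature.eq_one_or_reflection [NeZero d] (h : HasSignature (gramL d) L 2 18)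
    {β : IdxL → ℤ} (hβ : IsPrimitiveVector β) (hV : heegnerV d L = Submodule.span ℤ {β})
    (hneg : form ℤ (gramL d) β β < 0) {f : isometryGroup (gramL d)}
    (hf : ∀ x ∈ L, f.1.val *ᵥ x = x) :
    f = 1 ∨ ∀ x, ∃ n : ℤ, 2 * form ℤ (gramL d) x β = n * form ℤ (gramL d) β β ∧
      f.1.val *ᵥ x = x - n • β := by
  have hβV : β ∈ heegnerV d L := hV ▸ Submodule.mem_span_singleton_self β
  have hβ0 : vecCast ℝ β ≠ 0 := fun h0 => by
    rw [← map_zero (vecCast ℝ)] at h0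
    rw [vecCast_injective h0] at hneg
    simp at hneg
  have horth : ∀ y, form ℤ (gramL d) β y = 0 → f.1.val *ᵥ y = y := fun y hy => by
    have hyL := h.mem_scalarExt_of_form_eq_zero (form_eq_zero_of_mem_heegnerV hβV) hβ0
      (w := vecCast ℝ y) (by rw [form_vecCast, hy, Int.cast_zero])
    have := extend_eq_self_of_mem_scalarExt hf hyL
    rw [extend_vecCast] at this
    exact vecCast_injective this
  have hfβ : f.1.val *ᵥ β ∈ heegnerV d L := mem_heegnerV.mpr fun x hx => by
    rw [← hf x hx, f.2, mem_heegnerV.mp hβV x hx]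
  rw [hV] at hfβ
  obtain ⟨c, hc⟩ := Submodule.mem_span_singleton.mp hfβ
  set b := form ℤ (gramL d) β β with hb
  have hc2 : c * c = 1 := by
    have := f.2 β β
    rw [← hc, map_smul, map_smul, LinearMap.smul_apply, smul_eq_mul, smul_eq_mul, ← hb] at this
    refine mul_right_cancel₀ hneg.ne ?_
    linear_combination this
  have hx : ∀ x, b • (f.1.val *ᵥ x) =
      b • x + ((c - 1) * form ℤ (gramL d) x β) • β := fun x => by
    have := horth (b • x - form ℤ (gramL d) x β • β) <| by
      rw [map_sub, map_smul, map_smul, smul_eq_mul, smul_eq_mul, ← hb,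
        form_comm ℤ (isSymm_gramL d) β x]
      ring
    rw [Matrix.mulVec_sub, Matrix.mulVec_smul, Matrix.mulVec_smul, ← hc] at this
    rw [sub_eq_iff_eq_add.mp this]
    module
  rcases mul_self_eq_one_iff.mp hc2 with rfl | rfl
  · left
    refine Subtype.ext (Units.ext (Matrix.ext_of_mulVec_single fun i => ?_))
    have := hx (Pi.single i 1)
    rw [sub_self, zero_mul, zero_smul, add_zero] at this
    rw [smul_right_injective _ hneg.ne this]
    exact (Matrix.one_mulVec _).symm
  · right
    obtain ⟨u, hu⟩ := hβ.exists_dotProduct_eq_one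
    refine fun x => ⟨u ⬝ᵥ (x - f.1.val *ᵥ x), ?_, ?_⟩
    · have := congrArg (u ⬝ᵥ ·) (hx x)
      simp only [dotProduct_add, dotProduct_smul, hu, smul_eq_mul] at this
      rw [dotProduct_sub]
      linear_combination this
    · have := congrArg (u ⬝ᵥ ·) (hx x)
      simp only [dotProduct_add, dotProduct_smul, hu, smul_eq_mul] at this
      refine smul_right_injective _ hneg.ne ?_
      change b • _ = b • _
      rw [hx x, smul_sub, smul_smul, dotProduct_sub, sub_eq_add_neg (b • x), ← neg_smul]
      congr 2
      linear_combination -this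

/-! ### Reflections and the discriminant group -/

lemma smul_kappa_eq_zero_iff [NeZero d] (n : ℤ) : n • kappa d = 0 ↔ 2 * (d : ℤ) ∣ n := by
  have hd : (d : ℚ) ≠ 0 := Nat.cast_ne_zero.mpr (NeZero.ne d)
  rw [kappa, ← Submodule.Quotient.mk_smul, Submodule.Quotient.mk_eq_zero]
  constructor
  · rintro ⟨w, hw⟩
    have h : (w (Sum.inl ()) : ℚ) = n • (1 / (2 * (d : ℚ))) := congrFun hw (Sum.inl ())
    refine ⟨w (Sum.inl ()), ?_⟩
    rw [zsmul_eq_mul] at h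
    field_simp at h
    have h' : (n : ℚ) = ((2 * (d : ℤ) * w (Sum.inl ()) : ℤ) : ℚ) := by
      push_cast
      linarith
    exact_mod_cast h'
  · rintro ⟨c, rfl⟩
    refine ⟨c • vecK, ?_⟩
    funext i
    change vecCast ℚ (c • vecK) i =
      (2 * (d : ℤ) * c) • (Sum.elim (fun _ => 1 / (2 * (d : ℚ))) 0 : IdxL → ℚ) i
    rcases i with i | i
    · simp [vecCast, vecK]
      field_simp
    · simp [vecCast, vecK]

lemma toG2d_eq_one_iff [NeZero d] {f : isometryGroup (gramL d)} {u : ℤ}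
    (hu : (discHom d f).1.val (kappa d) = u • kappa d) :
    toG2d d f = 1 ↔ 2 * (d : ℤ) ∣ u - 1 ∨ 2 * (d : ℤ) ∣ u + 1 := by
  have h1 : 2 * (d : ℤ) ∣ u - 1 ↔ discHom d f = 1 := by
    rw [← smul_kappa_eq_zero_iff, sub_smul, sub_eq_zero, ← hu, one_smul]
    exact ⟨fun h => isoDisc_ext h, fun h => by rw [h]; rfl⟩
  have h2 : 2 * (d : ℤ) ∣ u + 1 ↔ discHom d f = discHom d (negIso d) := by
    have hneg : (discHom d (negIso d)).1.val (kappa d) = -kappa d := by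
      rw [discHom_negIso]; rfl
    rw [← smul_kappa_eq_zero_iff, add_smul, add_eq_zero_iff_eq_neg, ← hu, one_smul, ← hneg]
    exact ⟨fun h => isoDisc_ext h, fun h => by rw [h]⟩
  rw [h1, h2]
  refine (QuotientGroup.eq_one_iff (discHom d f)).trans (or_congr ?_ ?_)
  · exact ⟨fun h => Subtype.ext h, fun h => by rw [h]; rfl⟩
  · rw [← discHom_negIso]
    exact ⟨fun h => Subtype.ext h, fun h => by rw [h]⟩

lemma form_vecK (α : ℤ) (y : IdxM → ℤ) :
    form ℤ (gramL d) vecK (Sum.elim (fun _ => α) y) = -(2 * (d : ℤ)) * α := by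
  have e : vecK ∘ Sum.inr = (0 : IdxM → ℤ) := rfl
  rw [form_gramL, e, map_zero, LinearMap.zero_apply]
  simp [vecK]

lemma form_self_elim (α m : ℤ) (j : IdxM → ℤ) :
    form ℤ (gramL d) (Sum.elim (fun _ => α) (m • j)) (Sum.elim (fun _ => α) (m • j)) =
      -(2 * (d : ℤ)) * α ^ 2 + m ^ 2 * form ℤ gramM j j := by
  rw [form_gramL, Sum.elim_comp_inr, map_smul, map_smul, LinearMap.smul_apply]
  simp only [Sum.elim_inl, smul_eq_mul]
  ring

/-- The reflection in `β = α k + m j` acts on the discriminant group as multiplication by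
`1 - n α`, where `n = 2 (k · β) / β²`. -/
lemma toG2d_reflection_eq_one_iff [NeZero d] {f : isometryGroup (gramL d)} {α m n t : ℤ}
    {j : IdxM → ℤ} {b : ℤ} (hb : b ≠ 0) (ht : 2 * m = b * t) (hn : n * b = -(4 * d * α))
    (hf : f.1.val *ᵥ vecK = vecK - n • Sum.elim (fun _ => α) (m • j)) :
    toG2d d f = 1 ↔ 2 * (d : ℤ) ∣ n * α ∨ 2 * (d : ℤ) ∣ 2 - n * α := by
  have hnm : n * m = -(2 * d * α * t) := by
    refine mul_right_cancel₀ hb ?_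
    linear_combination m * hn - 2 * d * α * ht
  rw [toG2d_eq_one_iff (discHom_kappa f (1 - n * α) (incM ((α * t) • j)) ?_),
    ← dvd_neg (b := n * α)]
  · ring_nf
  · rw [hf]
    funext i
    rcases i with i | i
    · simp [vecK]
    · have : n * (m * j i) = -(2 * d * (α * t * j i)) := by linear_combination j i * hnm
      simp [vecK, this]

/-- The reflection in a vector `β` is defined over `ℤ` if `β²` divides `2 (x · β)` for all `x`. -/
lemma exists_reflection {β : IdxL → ℤ} (hb : form ℤ (gramL d) β β ≠ 0)
    (h : ∀ x, form ℤ (gramL d) β β ∣ 2 * form ℤ (gramL d) x β) :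
    ∃ f : isometryGroup (gramL d), ∀ x, ∃ n : ℤ,
      n * form ℤ (gramL d) β β = 2 * form ℤ (gramL d) x β ∧ f.1.val *ᵥ x = x - n • β := by
  choose ν hν using h
  set b := form ℤ (gramL d) β β with hbdef
  let φ : Module.Dual ℤ (IdxL → ℤ) :=
    { toFun := ν
      map_add' := fun x y => by
        apply mul_left_cancel₀ hb
        rw [← hν, map_add, LinearMap.add_apply, mul_add, mul_add, ← hν, ← hν]
      map_smul' := fun c x => by
        apply mul_left_cancel₀ hb
        rw [← hν, map_smul, LinearMap.smul_apply, RingHom.id_apply, smul_eq_mul, smul_eq_mul]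
        linear_combination c * hν x }
  have hφ : φ β = 2 := by
    apply mul_left_cancel₀ hb
    change b * ν β = _
    rw [← hν, ← hbdef, mul_comm]
  refine ⟨⟨ofEquiv (Module.reflection hφ), fun x y => ?_⟩, fun x => ⟨ν x, ?_, ?_⟩⟩
  · rw [ofEquiv_mulVec, ofEquiv_mulVec, Module.reflection_apply, Module.reflection_apply]
    change form ℤ (gramL d) (x - ν x • β) (y - ν y • β) = _
    simp only [map_sub, map_smul, LinearMap.sub_apply, LinearMap.smul_apply, smul_eq_mul]
    rw [form_comm ℤ (isSymm_gramL d) β y, ← hbdef]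
    apply mul_left_cancel₀ hb
    linear_combination (form ℤ (gramL d) x β - b * ν x) * hν y -
      form ℤ (gramL d) y β * hν x
  · rw [mul_comm, ← hν]
  · rw [ofEquiv_mulVec, Module.reflection_apply]
    rfl

lemma smul_eq_of_mem_subDomain {f : isometryGroup (gramL d)} (hf : ∀ x ∈ L, f.1.val *ᵥ x = x)
    {σ : periodDomain d} (hσ : σ ∈ subDomain d L) : f • σ = σ := by
  apply Subtype.ext
  obtain ⟨σ, hσ'⟩ := σ
  change f.1 • σ = σ
  induction σ using Projectivization.ind with
  | h v hv =>
    replace hσ : (Projectivization.mk ℂ v hv).submodule ≤ scalarExt ℂ L := hσ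
    rw [Projectivization.submodule_mk, Submodule.span_singleton_le_iff_mem] at hσ
    have e := extend_eq_self_of_mem_scalarExt hf hσ
    rw [smul_mk' _ _ _ (by rwa [e])]
    congr 1

/-- If `[f]` fixes `H_L` pointwise, then so does an element with the same class that is the identity
on `L`. -/
lemma HasSignature.exists_forall_mulVec_eq_self [NeZero d] (hsig : HasSignature (gramL d) L 2 18)
    {f : isometryGroup (gramL d)}
    (hf : heegner d L ⊆ MulAction.fixedBy (Moduli d) (toG2d d f)) :
    ∃ h : isometryGroup (gramL d), toG2d d h = toG2d d f ∧ ∀ x ∈ L, h.1.val *ᵥ x = x := by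
  obtain ⟨h, hh, c, hc⟩ := hsig.exists_extend_eq_smul hf
  rcases hsig.exists_mulVec_eq_smul hc with h1 | h1
  · exact ⟨h, hh, h1⟩
  · refine ⟨negIso d * h, ?_, fun x hx => ?_⟩
    · have : toG2d d (negIso d) = 1 :=
        (QuotientGroup.eq_one_iff _).mpr (Or.inr (discHom_negIso d))
      rw [map_mul, this, one_mul, hh]
    · change ((-1 : GL IdxL ℤ) * h.1).val *ᵥ x = x
      rw [neg_one_mul, Units.val_neg, Matrix.neg_mulVec, h1 x hx, neg_neg]

/-- If a non-trivial class fixes `H_L` pointwise, then it is the class of the reflection in a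
generator `β` of `V(H_L)`; integrality of the reflection gives the divisibilities in `ℜ`, and
non-triviality of the class excludes `β² = -2` and `β² = -2d`. -/
theorem mem_setR_of_fixed [NeZero d] (hsig : HasSignature (gramL d) L 2 18)
    {f : isometryGroup (gramL d)} (hf1 : toG2d d f ≠ 1)
    (hf : heegner d L ⊆ MulAction.fixedBy (Moduli d) (toG2d d f)) :
    heegnerV d L ∈ setR d := by
  obtain ⟨h, hh, hfix⟩ := hsig.exists_forall_mulVec_eq_self hf
  rw [← hh] at hf1
  obtain ⟨β, hβ, hV, hneg⟩ := hsig.exists_heegnerV_eq_span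
  have hrefl := (hsig.eq_one_or_reflection hβ hV hneg hfix).resolve_left
    fun h1 => hf1 (by rw [h1, map_one])
  obtain ⟨α, m, j, hj, rfl⟩ : ∃ (α m : ℤ) (j : IdxM → ℤ), IsPrimitiveVector j ∧
      β = Sum.elim (fun _ => α) (m • j) := by
    obtain ⟨m, j, hj, hmj⟩ := exists_eq_smul_isPrimitiveVector (β ∘ Sum.inr)
    refine ⟨β (Sum.inl ()), m, j, hj, ?_⟩
    rw [← hmj]
    exact (Sum.elim_comp_inl_inr β).symm
  have hcop := hβ.isCoprime
  obtain ⟨J, hJ⟩ := even_gramM j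
  have hb := form_self_elim (d := d) α m j
  rw [hJ] at hb
  obtain ⟨n, hn, hk⟩ := hrefl vecK
  rw [form_vecK] at hn
  -- Since `M` is unimodular, `m` is a value of the linear form `x ↦ x · β`.
  obtain ⟨y, hy⟩ := exists_form_gramM_eq_one hj
  obtain ⟨t, ht, -⟩ := hrefl (incM y)
  have hty : form ℤ (gramL d) (incM y) (Sum.elim (fun _ => α) (m • j)) = m := by
    rw [form_gramL, Sum.elim_comp_inr, Sum.elim_comp_inr, map_smul,
      form_comm ℤ isSymm_gramM, hy]
    simp
  rw [hty] at ht
  set b := form ℤ (gramL d) (Sum.elim (fun _ => α) (m • j)) (Sum.elim (fun _ => α) (m • j))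
    with hbdef
  have hdiv : b ∣ 2 * m := ⟨t, by rw [ht, mul_comm]⟩
  have htriv := toG2d_reflection_eq_one_iff hneg.ne (by rw [ht, mul_comm])
    (by linear_combination -hn) hk
  refine ⟨_, α, m, j, hV, hj, rfl, ⟨hβ, hdiv, ?_⟩, hneg, fun h2 => ?_, fun h2 => ?_⟩
  · obtain ⟨c, hc⟩ : Even b := even_gramL d _
    rw [← hbdef]
    rw [hc, ← two_mul] at hdiv hb ⊢
    have hcm : c ∣ m := (mul_dvd_mul_iff_left two_ne_zero).mp hdiv
    have hdα : (d : ℤ) * α ^ 2 = m * (m * J) - c := by linarith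
    refine mul_dvd_mul_left 2 ?_
    refine IsCoprime.dvd_of_dvd_mul_right (hcop.symm.of_isCoprime_of_dvd_left hcm).pow_right
      (hdα ▸ dvd_sub (hcm.mul_right _) dvd_rfl)
  · refine hf1 (htriv.mpr (Or.inl ⟨α ^ 2, ?_⟩))
    rw [← hbdef] at h2
    rw [h2] at hn
    have hn' : n = 2 * d * α := by linarith
    rw [hn']
    ring
  · rw [← hbdef] at h2
    have hd0 : (d : ℤ) ≠ 0 := Nat.cast_ne_zero.mpr (NeZero.ne d)
    have hm : m = -(d * t) := by rw [h2] at ht; linarith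
    have hn' : n = 2 * α := by
      refine mul_right_cancel₀ hd0 ?_
      rw [h2] at hn
      linarith
    refine hf1 (htriv.mpr (Or.inr ⟨-(t ^ 2 * J), ?_⟩))
    rw [h2, hm] at hb
    rw [hn']
    refine mul_right_cancel₀ hd0 ?_
    linear_combination -hb

/-- If `V(H_L) = ⟨β⟩` belongs to `ℜ`, the class of the reflection in `β` is non-trivial and fixes
`H_L` pointwise. -/
theorem exists_fixing_of_mem_setR [NeZero d] (h : heegnerV d L ∈ setR d) :
    ∃ g : G2d d, g ≠ 1 ∧ heegner d L ⊆ MulAction.fixedBy (Moduli d) g := by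
  obtain ⟨β, α, m, j, hV, -, rfl, ⟨hβ, ⟨t, ht⟩, ⟨e, he⟩⟩, hneg, hne2, hne2d⟩ := h
  have hcop := hβ.isCoprime
  have hb := form_self_elim (d := d) α m j
  set β : IdxL → ℤ := Sum.elim (fun _ => α) (m • j) with hβdef
  obtain ⟨c, hc⟩ : Even (form ℤ (gramL d) β β) := even_gramL d _
  obtain ⟨J, hJ⟩ := even_gramM j
  rw [hJ] at hb
  obtain ⟨f, hf⟩ := exists_reflection hneg.ne fun x => by
    have : form ℤ (gramL d) x β =
        -(2 * d) * (x (Sum.inl ()) * α) + m * form ℤ gramM (x ∘ Sum.inr) j := by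
      rw [form_gramL, hβdef, Sum.elim_comp_inr, map_smul, smul_eq_mul]
      rfl
    rw [this]
    refine ⟨-(2 * e * (x (Sum.inl ()) * α)) + t * form ℤ gramM (x ∘ Sum.inr) j, ?_⟩
    linear_combination -(2 * (x (Sum.inl ()) * α)) * he + form ℤ gramM (x ∘ Sum.inr) j * ht
  have hfL : ∀ x ∈ L, f.1.val *ᵥ x = x := fun x hx => by
    obtain ⟨n, hn, hfx⟩ := hf x
    have hβV : β ∈ heegnerV d L := hV ▸ Submodule.mem_span_singleton_self β
    rw [form_comm ℤ (isSymm_gramL d) x, mem_heegnerV.mp hβV x hx, mul_zero] at hn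
    rw [hfx, (mul_eq_zero.mp hn).resolve_right hneg.ne, zero_smul, sub_zero]
  obtain ⟨n, hn, hk⟩ := hf vecK
  rw [hβdef, form_vecK, ← hβdef] at hn
  refine ⟨toG2d d f, fun h1 => ?_, ?_⟩
  · set b := form ℤ (gramL d) β β
    have hd : (0 : ℤ) < d := Nat.cast_pos.mpr (Nat.pos_of_ne_zero (NeZero.ne d))
    have hm : m = c * t := by rw [hc] at ht; linarith
    have hde : (d : ℤ) = c * e := by rw [hc] at he; linarith
    have hc0 : c ≠ 0 := by omega
    have hnα : n = -(2 * e * α) := by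
      refine mul_right_cancel₀ hneg.ne ?_
      linear_combination hn - 2 * α * he
    rcases (toG2d_reflection_eq_one_iff hneg.ne ht (by linear_combination hn) hk).mp h1 with
      ⟨s, hs⟩ | ⟨s, hs⟩
    · -- Here `c = β² / 2` divides both `α²` and `m`.
      have he0 : e ≠ 0 := by rintro rfl; omega
      have hcα : c ∣ α ^ 2 := ⟨-s, by
        refine mul_left_cancel₀ he0 ?_
        rw [hnα, hde] at hs
        linarith⟩
      have hunit : IsUnit c :=
        (hcop.pow_left (m := 2)).isUnit_of_dvd' hcα ⟨t, hm⟩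
      rcases Int.isUnit_iff.mp hunit with h | h <;> omega
    · -- Here `e = 2 d / β²` divides `1`.
      have hunit : IsUnit e := isUnit_of_dvd_one ⟨c * s - α ^ 2, by
        rw [hnα, hde] at hs
        linarith⟩
      rcases Int.isUnit_iff.mp hunit with h | h <;> rw [h] at hde <;> omega
  · rintro _ ⟨σ, hσ, rfl⟩
    rw [MulAction.mem_fixedBy, toG2d_smul_toModuli, smul_eq_of_mem_subDomain hfL hσ]

end

end K3Period


theorem lemma3p5 (d : ℕ) [NeZero d] (L : Submodule ℤ (IdxL → ℤ))
    (hprim : IsPrimitiveSublattice L) (hsig : HasSignature (gramL d) L 2 18) :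
    (∃ g : G2d d, g ≠ 1 ∧ heegner d L ⊆ MulAction.fixedBy (Moduli d) g) ↔
      heegnerV d L ∈ setR d := by
  refine ⟨fun ⟨g, hg1, hg⟩ => ?_, exists_fixing_of_mem_setR⟩
  obtain ⟨f, rfl⟩ := toG2d_surjective d g
  exact mem_setR_of_fixed hsig hg1 hg
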